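/- A precontraction group is a totally ordered abelian group $\Gamma$ with a map $\chi:\Gamma\to\Gamma$ such that for all $a,b\in\Gamma$: $\chi(a)=0$ iff $a=0$; $a\le b$ implies $\chi(a)\le\chi(b)$; $\chi(-a)=-\chi(a)$; and $\chi(a)=\chi(b)$ whenever $a,b$ are archimedean equivalent and have the same sign. It is centripetal if $|\chi(a)|<|a|$ for all $a\ne 0$. Write $X:=\chi(\Gamma^{<0})$. Let $(\Gamma,\chi,c)$ be a model of $T_{pdg}$, that is, $(\Gamma,\chi)$ is a nontrivial centripetal precontraction group, $\Gamma$ is divisible (hence a $\mathbb{Q}$-vector space), $c$ is the least element of $X$, $\chi$ restricts to a bijection $X\to X^{>c}$, and for all $a<b$ in $X$ we have $a<\chi(a)\le b$. View $\Gamma_\infty=\Gamma\cup\{\infty\}$ (with $a<\infty$ for $a\in\Gamma$) as a structure in the language $\{+,-,0,<,\chi,c,\infty,\chi^{-1},\delta_1,\delta_2,\dots\}$, where $\delta_n$ is division by $n$; $x+\infty=\infty+x=\infty$ for all $x\in\Gamma_\infty$, and $-\infty=\chi(\infty)=\delta_n(\infty)=\infty$; and $\chi^{-1}(0)=0$, $\chi^{-1}(\chi(a))=a$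 and $\chi^{-1}(-\chi(a))=-a$ for $a\in X$, and $\chi^{-1}(y)=\infty$ for all other $y\in\Gamma_\infty$ (in particular for $y=c$ and $y=\infty$). Put $\chi^0(x)=x$ and $\chi^{k}=(\chi^{-1})^{-k}$ for integers $k<0$. Definable means definable in this structure with parameters, and a function is definable if its graph is. A $\chi$-function is a function $F:X\to\Gamma_\infty$ which is constant or of the form $$F(x)=\sum_{i=1}^n q_i\chi^{k_i}(x)-\alpha$$ with $n>0$, integers $k_1<\dots<k_n$, $q_1,\dots,q_n\in\mathbb{Q}\setminus\{0\}$ and $\alpha\in\Gamma$ (where $F(x)=\infty$ if some $\chi^{k_i}(x)=\infty$). Theorem. Let $G:\chi(\Gamma^{<0})\to\Gamma$ be a definable function. Then $G$ is given piecewise by $\chi$-functions: there are $c=a_1<a_2<\dots<a_m=0$ in $\chi(\Gamma^{<0})\cup\{0\}$ such that for each $i\in\{1,\dots,m-1\}$ there is a $\chi$-function which agrees with $G$ on $\{x\in\chi(\Gamma^{<0}): a_i\le x<a_{i+1}\}$. -/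

import Mathlib

noncomputable section

namespace Precontraction

variable {Γ : Type*} [AddCommGroup Γ] [LinearOrder Γ] [IsOrderedAddMonoid Γ]

/-- A precontraction map on a totally ordered abelian group. -/
structure IsPrecontraction (χ : Γ → Γ) : Prop where
  eq_zero_iff : ∀ a, χ a = 0 ↔ a = 0
  mono : ∀ a b, a ≤ b → χ a ≤ χ b
  neg : ∀ a, χ (-a) = -χ a
  arch : ∀ a b, ArchimedeanClass.mk a = ArchimedeanClass.mk b →
    SignType.sign a = SignType.sign b → χ a = χ b

/-- The precontraction map is centripetal. -/
def IsCentripetal (χ : Γ → Γ) : Prop :=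
  ∀ a, a ≠ 0 → |χ a| < |a|

/-- The set `χ(Γ^{<0})`. -/
def negImage (χ : Γ → Γ) : Set Γ := χ '' Set.Iio 0

/-- `(Γ, χ, c)` is a model of `T_pdg`: a nontrivial centripetal precontraction group such that
`c` is the least element of `χ(Γ^{<0})`, the map `χ` restricts to a bijection from `χ(Γ^{<0})` to
`χ(Γ^{<0})^{>c}`, the element `χ a` is the immediate successor of `a` in `χ(Γ^{<0})`, and `Γ` is
divisible. -/
structure IsTpdgModel (χ : Γ → Γ) (c : Γ) : Prop where
  nontrivial : Nontrivial Γ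
  precontraction : IsPrecontraction χ
  centripetal : IsCentripetal χ
  least : IsLeast (negImage χ) c
  bij : Set.BijOn χ (negImage χ) (negImage χ ∩ Set.Ioi c)
  succ : ∀ a ∈ negImage χ, ∀ b ∈ negImage χ, a < b → a < χ a ∧ χ a ≤ b
  divisible : ∀ n : ℕ, 0 < n → ∀ a : Γ, ∃ b : Γ, n • b = a

open Classical in
/-- Division by `n` in `Γ`: the (unique, for `n > 0`) `b` with `n • b = a`. The default value `0`
is never used when `Γ` is divisible and `n > 0`. -/
def divBy (n : ℕ) (a : Γ) : Γ :=
  if h : ∃ b : Γ, n • b = a then h.choose else 0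

/-- Multiplication by a rational number in a divisible ordered abelian group. -/
def ratMul (q : ℚ) (a : Γ) : Γ := q.num • divBy q.den a

/-- `χ` on `Γ_∞ = Γ ∪ {∞}`, with `χ ∞ = ∞`. -/
def chiTop (χ : Γ → Γ) : WithTop Γ → WithTop Γ := WithTop.map χ

open Classical in
/-- `χ⁻¹` on `Γ_∞`: it sends `0` to `0`, it inverts the bijection `χ` on `χ(Γ^{<0})` and, by
oddness, on `-χ(Γ^{<0})`, and it takes the value `∞` at all other points (in particular at `c`
and at `∞`). -/
def chiInv (χ : Γ → Γ) (y : WithTop Γ) : WithTop Γ :=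
  if y = 0 then 0
  else if h : ∃ a ∈ negImage χ, y = ((χ a : Γ) : WithTop Γ) then
    ((h.choose : Γ) : WithTop Γ)
  else if h : ∃ a ∈ negImage χ, y = ((-χ a : Γ) : WithTop Γ) then
    ((-h.choose : Γ) : WithTop Γ)
  else ⊤

/-- Function symbols of `L_pdg*`, by arity: the constants `0`, `c`, `∞`, the unary symbols `-`,
`χ`, `χ⁻¹`, `δ_n` (`n > 0`), and the binary symbol `+`. -/
inductive PdgFunc : ℕ → Type
  | zero : PdgFunc 0
  | c : PdgFunc 0
  | infty : PdgFunc 0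
  | neg : PdgFunc 1
  | chi : PdgFunc 1
  | chiInv : PdgFunc 1
  | delta (n : ℕ+) : PdgFunc 1
  | add : PdgFunc 2

/-- Relation symbols of `L_pdg*`: the binary symbol `<`. -/
inductive PdgRel : ℕ → Type
  | lt : PdgRel 2

/-- The language `L_pdg*`. -/
def Lpdgs : FirstOrder.Language.{0, 0} := ⟨PdgFunc, PdgRel⟩

/-- Interpretation of the function symbols of `L_pdg*` in `Γ_∞`. -/
def pdgFunMap (χ : Γ → Γ) (c : Γ) :
    {n : ℕ} → PdgFunc n → (Fin n → WithTop Γ) → WithTop Γ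
  | _, .zero, _ => 0
  | _, .c, _ => (c : WithTop Γ)
  | _, .infty, _ => ⊤
  | _, .neg, v => WithTop.map (fun a : Γ => -a) (v 0)
  | _, .chi, v => chiTop χ (v 0)
  | _, .chiInv, v => Precontraction.chiInv χ (v 0)
  | _, .delta n, v => WithTop.map (divBy (n : ℕ)) (v 0)
  | _, .add, v => v 0 + v 1

/-- Interpretation of the relation symbols of `L_pdg*` in `Γ_∞`; here `a < ∞` for `a ∈ Γ`. -/
def pdgRelMap : {n : ℕ} → PdgRel n → (Fin n → WithTop Γ) → Prop
  | _, .lt, v => v 0 < v 1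

/-- The expansion of `(Γ, χ, c)` to an `L_pdg*`-structure with underlying set `Γ_∞`. -/
abbrev pdgStructure (χ : Γ → Γ) (c : Γ) : Lpdgs.Structure (WithTop Γ) where
  funMap := pdgFunMap χ c
  RelMap := pdgRelMap

/-- A function `χ(Γ^{<0}) → Γ` is definable if its graph is definable, with parameters, in the
`L_pdg*`-structure `Γ_∞`. -/
def IsDefinableFun (χ : Γ → Γ) (c : Γ) (G : negImage χ → Γ) : Prop :=
  letI : Lpdgs.Structure (WithTop Γ) := pdgStructure χ c
  Set.Definable₂ (Set.univ : Set (WithTop Γ)) Lpdgs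
    {p : WithTop Γ × WithTop Γ |
      ∃ x : negImage χ, p = (((x : Γ) : WithTop Γ), ((G x : Γ) : WithTop Γ))}

/-- The iterates `χ^k`, `k ∈ ℤ`, on `Γ_∞`, where `χ^k = (χ⁻¹)^{-k}` for `k < 0`. -/
def chiPow (χ : Γ → Γ) : ℤ → WithTop Γ → WithTop Γ
  | .ofNat n => (chiTop χ)^[n]
  | .negSucc n => (chiInv χ)^[n + 1]

/-- `χ`-functions: constants, and the maps `x ↦ ∑ i, q i * χ^(k i) x - α` with `n > 0`,
`k` strictly increasing, all `q i` nonzero rational numbers and `α ∈ Γ`. The value is `∞` where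
some `χ^(k i) x` is `∞`. -/
def IsChiFunction (χ : Γ → Γ) (F : negImage χ → WithTop Γ) : Prop :=
  (∃ γ : WithTop Γ, ∀ x, F x = γ) ∨
  ∃ n : ℕ, 0 < n ∧ ∃ k : Fin n → ℤ, StrictMono k ∧ ∃ q : Fin n → ℚ, (∀ i, q i ≠ 0) ∧
    ∃ α : Γ, ∀ x : negImage χ,
      F x = (∑ i, WithTop.map (ratMul (q i)) (chiPow χ (k i) ((x : Γ) : WithTop Γ)))
        + ((-α : Γ) : WithTop Γ)

/-- `G` is given piecewise by `χ`-functions: there are `c = a 0 < a 1 < ... < a m = 0` in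
`χ(Γ^{<0}) ∪ {0}` such that on each interval `[a i, a (i + 1))` of `χ(Γ^{<0})` the function `G`
agrees with a `χ`-function. -/
def IsPiecewiseChi (χ : Γ → Γ) (c : Γ) (G : negImage χ → Γ) : Prop :=
  ∃ m : ℕ, ∃ a : Fin (m + 1) → Γ,
    (∀ i, a i ∈ negImage χ ∪ {0}) ∧ StrictMono a ∧ a 0 = c ∧ a (Fin.last m) = 0 ∧
    ∀ i : Fin m, ∃ F : negImage χ → WithTop Γ, IsChiFunction χ F ∧
      ∀ x : negImage χ, a i.castSucc ≤ (x : Γ) → (x : Γ) < a i.succ →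
        ((G x : Γ) : WithTop Γ) = F x

end Precontraction

end

/-! The argument is a back-and-forth in the ultrapower of `Γ` over `ℕ`, followed by compactness. The
map `val`, sending `a` to `χ (-|a|)`, is a convex valuation, and `X = χ(Γ^{<0})` carries a discrete
order whose successor map is `χ`. If an element of `X` lies outside a substructure `A`, its
predecessors never stop, so it spans a `ℤ`-indexed orbit. The elements of this orbit have pairwise
distinct values, and these values lie outside `A`. Hence `A` plus the span of the orbit is again a
substructure, and its isomorphism type over `A` depends only on the cut of the orbit's base point in
`A ∩ X` (`IsPartialIso.adjoin_orbit`).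

The ultrapower is countably saturated, so any countable partial isomorphism extends to any further
element (`IsPartialIso.exists_extend`). Orbits are adjoined until no new values remain, and the new
element is then placed by a Helly argument (`exists_chi_sub_eq`). It follows that formulas are
preserved by countable partial isomorphisms (`eventually_realize_iff`).

A definable `G` uses finitely many parameters; let `P` be a countable substructure containing them.
Elements outside a countable substructure can be moved while the substructure stays fixed
(`exists_move`). Therefore, at a nonstandard point `a` of `X` outside `P`, the value of `G` lies in
`P` plus the span of the orbit of `a`, which says exactly that it is the value at `a` of a
`χ`-function over `P`. The same `χ`-function then works at every point in the cut of `a` over `P`.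
If no finite subdivision of `X` sufficed, a diagonal choice of bad intervals would contradict this
(`exists_agree`). -/

namespace Precontraction

open Set Filter FirstOrder

set_option linter.unusedSectionVars false

/-! ### The valuation attached to a precontraction map. -/

section Algebra

variable {M : Type*} [AddCommGroup M] [LinearOrder M] [IsOrderedAddMonoid M]

/-- First-order consequences of `IsTpdgModel`, stable under ultrapowers. -/
structure IsPdgGroup (χ : M → M) (c : M) : Prop where
  nontrivial : Nontrivial M
  zero : χ 0 = 0
  mono : Monotone χ
  neg : ∀ a, χ (-a) = -χ a
  nsmul : ∀ n : ℕ, 0 < n → ∀ a, χ (n • a) = χ a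
  lt_chi : ∀ a < 0, a < χ a
  chi_neg : ∀ a < 0, χ a < 0
  least : IsLeast (negImage χ) c
  inj : InjOn χ (negImage χ)
  surj : ∀ x ∈ negImage χ, c < x → ∃ y ∈ negImage χ, χ y = x
  lt_chi_image : ∀ x ∈ negImage χ, c < χ x
  succ : ∀ a ∈ negImage χ, ∀ b ∈ negImage χ, a < b → χ a ≤ b

/-- Archimedean equivalence is not first order. Invariance of `χ` under positive multiples, together
with monotonicity, serves in its place. -/
theorem IsTpdgModel.isPdgGroup {χ : M → M} {c : M} (h : IsTpdgModel χ c) : IsPdgGroup χ c := by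
  have h0 : χ 0 = 0 := (h.precontraction.eq_zero_iff 0).2 rfl
  have hneg : ∀ a < 0, χ a < 0 := fun a ha => lt_of_le_of_ne
    (h0 ▸ h.precontraction.mono a 0 ha.le)
    (fun e => ha.ne ((h.precontraction.eq_zero_iff a).1 e))
  refine ⟨h.nontrivial, h0, h.precontraction.mono, h.precontraction.neg, ?_, ?_, hneg, h.least,
    h.bij.injOn, ?_, fun x hx => (h.bij.mapsTo hx).2, fun a ha b hb hab => (h.succ a ha b hb hab).2⟩
  · intro n hn a
    refine h.precontraction.arch _ _ ?_ ?_
    · rw [ArchimedeanClass.mk_eq_mk]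
      refine ⟨⟨1, ?_⟩, ⟨n, ?_⟩⟩
      · rw [one_smul, abs_nsmul]
        exact le_self_nsmul (abs_nonneg a) hn.ne'
      · rw [abs_nsmul]
    · rcases lt_trichotomy a 0 with ha | rfl | ha
      · rw [sign_neg ha, sign_neg (nsmul_neg ha hn.ne')]
      · simp
      · rw [sign_pos ha, sign_pos (nsmul_pos ha hn.ne')]
  · intro a ha
    have := h.centripetal a ha.ne
    rw [abs_of_neg ha, abs_of_neg (hneg a ha)] at this
    exact neg_lt_neg_iff.1 this
  · intro x hx hcx
    obtain ⟨y, hy, e⟩ := h.bij.surjOn ⟨hx, hcx⟩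
    exact ⟨y, hy, e⟩

/-- The valuation attached to `χ`; the value of `0` is the largest one, namely `0`. -/
def val (χ : M → M) (a : M) : M := χ (-|a|)

namespace IsPdgGroup

variable {χ : M → M} {c : M} (h : IsPdgGroup χ c)
include h

theorem chi_pos {a : M} (ha : 0 < a) : 0 < χ a := by
  have := h.chi_neg (-a) (neg_neg_of_pos ha)
  rw [h.neg] at this
  exact neg_neg_iff_pos.1 this

theorem chi_lt_zero_iff {a : M} : χ a < 0 ↔ a < 0 := by
  refine ⟨fun ha => ?_, h.chi_neg a⟩
  by_contra! hc
  exact ha.not_ge (h.zero ▸ h.mono hc)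

theorem chi_pos_iff {a : M} : 0 < χ a ↔ 0 < a := by
  refine ⟨fun ha => ?_, h.chi_pos⟩
  by_contra! hc
  exact ha.not_ge (h.zero ▸ h.mono hc)

theorem chi_eq_zero_iff {a : M} : χ a = 0 ↔ a = 0 := by
  refine ⟨fun ha => ?_, fun e => e ▸ h.zero⟩
  rcases lt_trichotomy a 0 with h1 | h1 | h1
  · exact absurd ha (h.chi_neg a h1).ne
  · exact h1
  · exact absurd ha (h.chi_pos h1).ne'

theorem neg_of_mem {x : M} (hx : x ∈ negImage χ) : x < 0 := by
  obtain ⟨a, ha, rfl⟩ := hx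
  exact h.chi_neg a ha

theorem chi_mem {a : M} (ha : a < 0) : χ a ∈ negImage χ := ⟨a, ha, rfl⟩

theorem chi_mem_of_mem {x : M} (hx : x ∈ negImage χ) : χ x ∈ negImage χ :=
  h.chi_mem (h.neg_of_mem hx)

theorem strictMonoOn : StrictMonoOn χ (negImage χ) := fun _ hx _ hy hxy =>
  lt_of_le_of_ne (h.mono hxy.le) fun e => hxy.ne (h.inj hx hy e)

theorem lt_chi_of_mem {x : M} (hx : x ∈ negImage χ) : x < χ x := h.lt_chi x (h.neg_of_mem hx)

theorem val_of_neg {a : M} (ha : a < 0) : val χ a = χ a := by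
  rw [val, abs_of_neg ha, neg_neg]

theorem val_of_pos {a : M} (ha : 0 < a) : val χ a = -χ a := by
  rw [val, abs_of_pos ha, h.neg]

theorem val_zero : val χ 0 = 0 := by simp [val, h.zero]

theorem val_neg (a : M) : val χ (-a) = val χ a := by simp [val]

theorem val_lt_zero {a : M} (ha : a ≠ 0) : val χ a < 0 :=
  h.chi_neg _ (by simpa using ha)

theorem val_le_zero (a : M) : val χ a ≤ 0 := by
  by_cases ha : a = 0
  · rw [ha, h.val_zero]
  · exact (h.val_lt_zero ha).le

theorem val_mem {a : M} (ha : a ≠ 0) : val χ a ∈ negImage χ :=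
  h.chi_mem (by simpa using ha)

theorem val_anti {a b : M} (hab : |a| ≤ |b|) : val χ b ≤ val χ a := h.mono (neg_le_neg hab)

theorem abs_lt_of_val_lt {a b : M} (hab : val χ a < val χ b) : |b| < |a| := by
  by_contra! hc
  exact hab.not_ge (h.val_anti hc)

theorem val_nsmul {n : ℕ} (hn : 0 < n) (a : M) : val χ (n • a) = val χ a := by
  rw [val, abs_nsmul, ← smul_neg, h.nsmul n hn, val]

/-- If `|a| ≤ |b|` then `|a + b| ≤ 2|b|`, and doubling does not change the value. -/
theorem min_val_le_val_add (a b : M) : min (val χ a) (val χ b) ≤ val χ (a + b) := by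
  wlog hab : |a| ≤ |b| generalizing a b
  · rw [min_comm, add_comm]; exact this b a (le_of_not_ge hab)
  refine (min_le_right _ _).trans ?_
  rw [← h.val_nsmul two_pos b]
  refine h.val_anti ?_
  rw [abs_nsmul, two_smul]
  exact (abs_add_le a b).trans (add_le_add_left hab _)

theorem lt_val_add {t a b : M} (ha : t < val χ a) (hb : t < val χ b) : t < val χ (a + b) :=
  (lt_min ha hb).trans_le (h.min_val_le_val_add a b)

theorem lt_val_sum {ι : Type*} {t : M} (s : Finset ι) (f : ι → M) (ht : t < 0)
    (hf : ∀ i ∈ s, t < val χ (f i)) : t < val χ (∑ i ∈ s, f i) := by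
  classical
  induction s using Finset.induction_on with
  | empty => simpa [h.val_zero] using ht
  | insert i s hi ih =>
    rw [Finset.sum_insert hi]
    exact h.lt_val_add (hf i (by simp)) (ih fun j hj => hf j (by simp [hj]))

/-- The leading term decides. For `a < 0` the hypothesis gives `2|b| < |a|`, so `2a ≤ a + b` and
`2(a + b) ≤ a`; since `χ` is monotone and blind to doubling, both bounds give `χ a`. -/
theorem chi_add_of_val_lt {a b : M} (hab : val χ a < val χ b) : χ (a + b) = χ a := by
  wlog ha : a < 0 generalizing a b
  · have ha' : a ≠ 0 := by
      rintro rfl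
      rw [h.val_zero] at hab
      exact hab.not_ge (h.val_le_zero b)
    have := this (a := -a) (b := -b) (by rwa [h.val_neg, h.val_neg])
      (neg_neg_of_pos (lt_of_le_of_ne (not_lt.1 ha) ha'.symm))
    rw [← neg_add, h.neg, h.neg] at this
    exact neg_inj.1 this
  have h2 := h.abs_lt_of_val_lt (a := a) (b := 2 • b) (by rwa [h.val_nsmul two_pos])
  rw [abs_of_neg ha, abs_lt, two_smul] at h2
  have hb := h.abs_lt_of_val_lt hab
  rw [abs_of_neg ha, abs_lt, neg_neg] at hb
  refine le_antisymm ?_ ?_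
  · rw [← h.nsmul 2 two_pos (a + b)]
    refine h.mono ?_
    rw [two_smul]
    calc a + b + (a + b) = a + a + (b + b) := by abel
      _ ≤ a + a + -a := add_le_add_right h2.2.le _
      _ = a := by abel
  · rw [← h.nsmul 2 two_pos a, two_smul]
    exact h.mono (add_le_add_right hb.1.le a)

theorem val_eq_of_chi_eq {a b : M} (hab : χ a = χ b) : val χ a = val χ b := by
  rcases lt_trichotomy a 0 with ha | rfl | ha
  · rw [h.val_of_neg ha, h.val_of_neg (h.chi_lt_zero_iff.1 (hab ▸ h.chi_neg a ha)), hab]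
  · rw [h.zero, eq_comm, h.chi_eq_zero_iff] at hab
    rw [hab]
  · rw [h.val_of_pos ha, h.val_of_pos (h.chi_pos_iff.1 (hab ▸ h.chi_pos ha)), hab]

theorem chi_eq_val_or (a : M) : χ a = val χ a ∨ χ a = -val χ a := by
  rcases lt_trichotomy a 0 with ha | rfl | ha
  · exact Or.inl (h.val_of_neg ha).symm
  · simp [h.zero, h.val_zero]
  · exact Or.inr (by rw [h.val_of_pos ha, neg_neg])

section Rat

variable [Module ℚ M]

theorem chi_smul_pos {q : ℚ} (hq : 0 < q) (a : M) : χ (q • a) = χ a := by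
  have hn : 0 < q.num.toNat := by
    have := Rat.num_pos.2 hq
    omega
  have e : q.den • (q • a) = q.num.toNat • a := by
    rw [← Nat.cast_smul_eq_nsmul ℚ, ← Nat.cast_smul_eq_nsmul ℚ, smul_smul]
    congr 1
    have h1 : ((q.num.toNat : ℕ) : ℚ) = (q.num : ℚ) := by
      have : ((q.num.toNat : ℕ) : ℤ) = q.num := Int.toNat_of_nonneg (Rat.num_pos.2 hq).le
      exact_mod_cast this
    rw [h1, mul_comm, Rat.mul_den_eq_num]
  rw [← h.nsmul q.den q.pos (q • a), e, h.nsmul _ hn]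

theorem chi_smul_neg {q : ℚ} (hq : q < 0) (a : M) : χ (q • a) = -χ a := by
  rw [← h.chi_smul_pos (neg_pos.2 hq) a, neg_smul, h.neg, neg_neg]

theorem val_smul {q : ℚ} (hq : q ≠ 0) (a : M) : val χ (q • a) = val χ a := by
  rcases lt_or_gt_of_ne hq with h1 | h1
  · rw [← h.val_neg a]
    exact h.val_eq_of_chi_eq (by rw [h.chi_smul_neg h1, h.neg])
  · exact h.val_eq_of_chi_eq (h.chi_smul_pos h1 a)

end Rat

end IsPdgGroup

end Algebra

/-! ### Partial isomorphisms and the adjunction of orbits. -/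

section PartialIso

variable {M : Type*} [AddCommGroup M] [LinearOrder M] [IsOrderedAddMonoid M] [Module ℚ M]

/-- The graph of an isomorphism between two substructures. -/
structure IsPartialIso (χ : M → M) (c : M) (R : Submodule ℚ (M × M)) : Prop where
  pos : ∀ z ∈ R, 0 < z.1 ↔ 0 < z.2
  chi : ∀ z ∈ R, (χ z.1, χ z.2) ∈ R
  c_mem : (c, c) ∈ R
  pred : ∀ x ∈ negImage χ, ∀ x' ∈ negImage χ, (χ x, χ x') ∈ R → (x, x') ∈ R

/-- The underlying group of a substructure. -/
structure IsSubstructure (χ : M → M) (c : M) (A : Submodule ℚ M) : Prop where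
  chi : ∀ a ∈ A, χ a ∈ A
  c_mem : c ∈ A
  pred : ∀ x ∈ negImage χ, χ x ∈ A → x ∈ A

/-- The graph of the identity of `A`. -/
def diag (A : Submodule ℚ M) : Submodule ℚ (M × M) :=
  A.map (LinearMap.id.prod LinearMap.id)

theorem mem_diag {A : Submodule ℚ M} {z : M × M} : z ∈ diag A ↔ z.1 ∈ A ∧ z.1 = z.2 := by
  constructor
  · rintro ⟨a, ha, rfl⟩
    exact ⟨ha, rfl⟩
  · rintro ⟨h1, h2⟩
    exact ⟨z.1, h1, Prod.ext rfl h2⟩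

/-- The graph of the inverse. -/
def swapRel (R : Submodule ℚ (M × M)) : Submodule ℚ (M × M) :=
  R.comap ((LinearMap.snd ℚ M M).prod (LinearMap.fst ℚ M M))

theorem mem_swapRel {R : Submodule ℚ (M × M)} {z : M × M} : z ∈ swapRel R ↔ (z.2, z.1) ∈ R :=
  Iff.rfl

/-- The domain of a partial isomorphism. -/
def relDom (R : Submodule ℚ (M × M)) : Submodule ℚ M := R.map (LinearMap.fst ℚ M M)

theorem mem_relDom {R : Submodule ℚ (M × M)} {a : M} : a ∈ relDom R ↔ ∃ a', (a, a') ∈ R := by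
  constructor
  · rintro ⟨z, hz, rfl⟩
    exact ⟨z.2, hz⟩
  · rintro ⟨a', h⟩
    exact ⟨_, h, rfl⟩

theorem IsPartialIso.swap {χ : M → M} {c : M} {R : Submodule ℚ (M × M)}
    (hR : IsPartialIso χ c R) : IsPartialIso χ c (swapRel R) :=
  ⟨fun _ hz => (hR.pos _ hz).symm, fun _ hz => hR.chi _ hz, hR.c_mem,
    fun x hx x' hx' hxx => hR.pred x' hx' x hx hxx⟩

theorem IsSubstructure.isPartialIso_diag {χ : M → M} {c : M} {A : Submodule ℚ M}
    (hχ : IsPdgGroup χ c) (hA : IsSubstructure χ c A) : IsPartialIso χ c (diag A) := by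
  refine ⟨?_, ?_, ?_, ?_⟩
  · intro z hz
    rw [(mem_diag.1 hz).2]
  · intro z hz
    obtain ⟨h1, h2⟩ := mem_diag.1 hz
    exact mem_diag.2 ⟨hA.chi _ h1, congrArg χ h2⟩
  · exact mem_diag.2 ⟨hA.c_mem, rfl⟩
  · intro x hx x' hx' hxx
    obtain ⟨h1, h2⟩ := mem_diag.1 hxx
    exact mem_diag.2 ⟨hA.pred x hx h1, hχ.inj hx hx' h2⟩

namespace IsPartialIso

variable {χ : M → M} {c : M} {R : Submodule ℚ (M × M)}

/-- The relation is linear, so applying `pos` to differences gives order preservation, hence also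
single-valuedness and injectivity. -/
theorem lt_iff (hR : IsPartialIso χ c R) {a a' b b' : M} (ha : (a, a') ∈ R) (hb : (b, b') ∈ R) :
    a < b ↔ a' < b' := by
  have := hR.pos _ (R.sub_mem hb ha)
  simpa using this

theorem eq_iff (hR : IsPartialIso χ c R) {a a' b b' : M} (ha : (a, a') ∈ R) (hb : (b, b') ∈ R) :
    a = b ↔ a' = b' := by
  rw [eq_iff_le_not_lt, eq_iff_le_not_lt, ← not_lt, ← not_lt, hR.lt_iff ha hb, hR.lt_iff hb ha]

theorem zero_iff (hR : IsPartialIso χ c R) {a a' : M} (ha : (a, a') ∈ R) : a = 0 ↔ a' = 0 :=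
  hR.eq_iff ha R.zero_mem

theorem neg_iff (hR : IsPartialIso χ c R) {a a' : M} (ha : (a, a') ∈ R) : a < 0 ↔ a' < 0 :=
  hR.lt_iff ha R.zero_mem

theorem val_mem (hR : IsPartialIso χ c R) {a a' : M} (ha : (a, a') ∈ R) :
    (val χ a, val χ a') ∈ R := by
  refine hR.chi (-|a|, -|a'|) ?_
  rcases lt_or_ge a 0 with h | h
  · rwa [abs_of_neg h, abs_of_neg ((hR.neg_iff ha).1 h), neg_neg, neg_neg]
  · have h' : 0 ≤ a' := by
      rw [← not_lt] at h ⊢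
      rwa [← hR.neg_iff ha]
    rw [abs_of_nonneg h, abs_of_nonneg h']
    exact R.neg_mem ha

/-- Preservation of `X` need not be an axiom. Since `c < χ x`, also `c < χ z`, so `χ z` has a
predecessor in `X`; the clause `pred` pairs that predecessor with `x`, so it equals `z`. -/
theorem image_mem (hχ : IsPdgGroup χ c) (hR : IsPartialIso χ c R) {x z : M} (h : (x, z) ∈ R)
    (hx : x ∈ negImage χ) : z ∈ negImage χ := by
  have hz : z < 0 := (hR.neg_iff h).1 (hχ.neg_of_mem hx)
  have h2 := hR.chi _ h
  obtain ⟨z1, hz1, e⟩ := hχ.surj (χ z) (hχ.chi_mem hz)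
    ((hR.lt_iff hR.c_mem h2).1 (hχ.lt_chi_image x hx))
  simp only at h2
  rw [← e] at h2
  rwa [(hR.eq_iff h (hR.pred x hx z1 hz1 h2)).1 rfl]

theorem isSubstructure_relDom (hχ : IsPdgGroup χ c) (hR : IsPartialIso χ c R) :
    IsSubstructure χ c (relDom R) := by
  refine ⟨?_, ?_, ?_⟩
  · intro a ha
    obtain ⟨a', ha⟩ := mem_relDom.1 ha
    exact mem_relDom.2 ⟨_, hR.chi _ ha⟩
  · exact mem_relDom.2 ⟨_, hR.c_mem⟩
  · intro x hx h
    obtain ⟨y, hy⟩ := mem_relDom.1 h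
    have hyX := hR.image_mem hχ hy (hχ.chi_mem_of_mem hx)
    obtain ⟨z1, hz1, e⟩ := hχ.surj y hyX ((hR.lt_iff hR.c_mem hy).1 (hχ.lt_chi_image x hx))
    rw [← e] at hy
    exact mem_relDom.2 ⟨z1, hR.pred x hx z1 hz1 hy⟩

/-- A criterion for an extension of a partial isomorphism to be a partial isomorphism: the values
of `χ` are old, or belong to a family `O` of pairs which is closed under predecessors. -/
theorem extend (hχ : IsPdgGroup χ c) (hR : IsPartialIso χ c R) {R' : Submodule ℚ (M × M)}
    (hle : R ≤ R') (O : Set (M × M)) (hO : ∀ z ∈ O, z ∈ R' ∧ z.1 ∈ negImage χ ∧ z.2 ∈ negImage χ ∧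
      ∃ y ∈ O, χ y.1 = z.1 ∧ χ y.2 = z.2)
    (key : ∀ z ∈ R', (∃ w ∈ R, χ z.1 = χ w.1 ∧ χ z.2 = χ w.2) ∨
      (∃ w ∈ O, χ z.1 = w.1 ∧ χ z.2 = w.2) ∨ ∃ w ∈ O, χ z.1 = -w.1 ∧ χ z.2 = -w.2) :
    IsPartialIso χ c R' := by
  refine ⟨?_, ?_, hle hR.c_mem, ?_⟩
  · intro z hz
    -- The sign of an element is the sign of its `χ`, which `key` controls.
    rw [← hχ.chi_pos_iff, ← hχ.chi_pos_iff (a := z.2)]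
    rcases key z hz with ⟨w, hw, e1, e2⟩ | ⟨w, hw, e1, e2⟩ | ⟨w, hw, e1, e2⟩
    · rw [e1, e2]
      exact hR.pos _ (hR.chi w hw)
    · obtain ⟨-, h1, h2, -⟩ := hO w hw
      rw [e1, e2]
      exact iff_of_false (hχ.neg_of_mem h1).not_gt (hχ.neg_of_mem h2).not_gt
    · obtain ⟨-, h1, h2, -⟩ := hO w hw
      rw [e1, e2]
      exact iff_of_true (neg_pos.2 (hχ.neg_of_mem h1)) (neg_pos.2 (hχ.neg_of_mem h2))
  · intro z hz
    rcases key z hz with ⟨w, hw, e1, e2⟩ | ⟨w, hw, e1, e2⟩ | ⟨w, hw, e1, e2⟩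
    · rw [e1, e2]
      exact hle (hR.chi w hw)
    · rw [e1, e2]
      exact (hO w hw).1
    · rw [e1, e2]
      exact R'.neg_mem (hO w hw).1
  · intro x hx x' hx' hxx
    have hcx := hχ.chi_mem_of_mem hx
    have hcx' := hχ.chi_mem_of_mem hx'
    -- Here `key` describes `χ (χ x)` and `χ (χ x')`, so two steps back are needed: through `pred`
    -- for old values, through the closure of `O` for new ones.
    rcases key _ hxx with ⟨w, hw, e1, e2⟩ | ⟨w, hw, e1, e2⟩ | ⟨w, hw, e1, e2⟩
    · have := hR.chi w hw
      rw [← e1, ← e2] at this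
      exact hle (hR.pred x hx x' hx' (hR.pred _ hcx _ hcx' this))
    · obtain ⟨-, -, -, y, hy, f1, f2⟩ := hO w hw
      obtain ⟨-, h1, h2, t, ht, g1, g2⟩ := hO y hy
      obtain ⟨ht', h3, h4, -⟩ := hO t ht
      have i1 := hχ.inj h1 hcx (f1.trans e1.symm)
      have i2 := hχ.inj h2 hcx' (f2.trans e2.symm)
      rw [← hχ.inj h3 hx (g1.trans i1), ← hχ.inj h4 hx' (g2.trans i2)]
      exact ht'
    · exfalso
      have h1 := hχ.neg_of_mem (hχ.chi_mem_of_mem hcx)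
      have h2 := hχ.neg_of_mem (hO w hw).2.1
      simp only at e1
      rw [e1] at h1
      exact lt_asymm h2 (neg_neg_iff_pos.1 h1)

/-- Adjoining an element `y` such that all `χ (y - a)` are already present. -/
theorem extend_singleton (hχ : IsPdgGroup χ c) (hR : IsPartialIso χ c R) {y y' : M}
    (hy : ∀ z ∈ R, (χ (y - z.1), χ (y' - z.2)) ∈ R) :
    IsPartialIso χ c (R ⊔ Submodule.span ℚ {(y, y')}) := by
  -- A new element is a nonzero rational multiple of some `y - a` with `a` old, so no new values of
  -- `χ` appear.
  have key : ∀ z ∈ R ⊔ Submodule.span ℚ {(y, y')}, (χ z.1, χ z.2) ∈ R := by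
    intro z hz
    obtain ⟨w, hw, t, ht, rfl⟩ := Submodule.mem_sup.1 hz
    obtain ⟨q, rfl⟩ := Submodule.mem_span_singleton.1 ht
    by_cases hq : q = 0
    · simpa [hq] using hR.chi w hw
    have h1 := hy _ (R.smul_mem (-q⁻¹) hw)
    have e : ∀ a b : M, a + q • b = q • (b - (-q⁻¹) • a) := by
      intro a b
      rw [smul_sub, smul_smul, mul_neg, mul_inv_cancel₀ hq, neg_one_smul, sub_neg_eq_add, add_comm]
    simp only [Prod.fst_add, Prod.snd_add, Prod.smul_fst, Prod.smul_snd, e] at h1 ⊢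
    rcases lt_or_gt_of_ne hq with h2 | h2
    · rw [hχ.chi_smul_neg h2, hχ.chi_smul_neg h2]
      exact R.neg_mem h1
    · rw [hχ.chi_smul_pos h2, hχ.chi_smul_pos h2]
      exact h1
  have hsub : ∀ z ∈ R ⊔ Submodule.span ℚ {(y, y')}, 0 < z.1 ↔ 0 < z.2 := fun z hz => by
    rw [← hχ.chi_pos_iff, ← hχ.chi_pos_iff (a := z.2)]
    exact hR.pos _ (key z hz)
  refine ⟨hsub, fun z hz => le_sup_left (a := R) (key z hz), le_sup_left (a := R) hR.c_mem, ?_⟩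
  intro x hx x' hx' hxx
  exact le_sup_left (a := R) (hR.pred x hx x' hx'
    (hR.pred _ (hχ.chi_mem_of_mem hx) _ (hχ.chi_mem_of_mem hx') (key _ hxx)))

end IsPartialIso

/-- An orbit of `χ` on `χ(Γ^{<0})`, indexed by `ℤ`. -/
def IsOrbit (χ : M → M) (u : ℤ → M) : Prop := ∀ k, u k ∈ negImage χ ∧ u (k + 1) = χ (u k)

namespace IsOrbit

variable {χ : M → M} {c : M} {u : ℤ → M}

theorem strictMono (hχ : IsPdgGroup χ c) (hu : IsOrbit χ u) : StrictMono u :=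
  strictMono_int_of_lt_succ fun k => by
    rw [(hu k).2]
    exact hχ.lt_chi_of_mem (hu k).1

theorem val_eq (hχ : IsPdgGroup χ c) (hu : IsOrbit χ u) (k : ℤ) : val χ (u k) = u (k + 1) := by
  rw [hχ.val_of_neg (hχ.neg_of_mem (hu k).1), (hu k).2]

theorem mem_iff (hu : IsOrbit χ u) {A : Submodule ℚ M} (hA : IsSubstructure χ c A) (k : ℤ) :
    u k ∈ A ↔ u 0 ∈ A := by
  have step : ∀ k, u (k + 1) ∈ A ↔ u k ∈ A := fun k =>
    ⟨fun hk => hA.pred _ (hu k).1 ((hu k).2 ▸ hk), fun hk => (hu k).2 ▸ hA.chi _ hk⟩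
  induction k using Int.induction_on with
  | zero => rfl
  | succ k ih => exact (step _).trans ih
  | pred k ih =>
    have := step (-k - 1)
    rw [sub_add_cancel] at this
    exact this.symm.trans ih

theorem notMem (hu : IsOrbit χ u) {A : Submodule ℚ M} (hA : IsSubstructure χ c A)
    (h0 : u 0 ∉ A) (k : ℤ) : u k ∉ A := (hu.mem_iff hA k).not.2 h0

/-- The value of `u j` is `u (j + 1)`, which increases strictly with `j`; the term of least index
therefore dominates. -/
theorem chi_linearCombination (hχ : IsPdgGroup χ c) (hu : IsOrbit χ u) {f : ℤ →₀ ℚ} {k : ℤ}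
    (hk : k ∈ f.support) (hmin : ∀ j ∈ f.support, k ≤ j) :
    χ (Finsupp.linearCombination ℚ u f) = χ (f k • u k) := by
  classical
  rw [Finsupp.linearCombination_apply, Finsupp.sum, ← Finset.add_sum_erase _ _ hk]
  refine hχ.chi_add_of_val_lt ?_
  rw [hχ.val_smul (Finsupp.mem_support_iff.1 hk), hu.val_eq hχ]
  refine hχ.lt_val_sum _ _ (hχ.neg_of_mem (hu _).1) fun j hj => ?_
  obtain ⟨hj1, hj2⟩ := Finset.mem_erase.1 hj
  rw [hχ.val_smul (Finsupp.mem_support_iff.1 hj2), hu.val_eq hχ]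
  exact hu.strictMono hχ (by have := hmin j hj2; omega)

end IsOrbit

theorem linearCombination_prod {ι : Type*} (u u' : ι → M) (f : ι →₀ ℚ) :
    Finsupp.linearCombination ℚ (fun k => (u k, u' k)) f =
      (Finsupp.linearCombination ℚ u f, Finsupp.linearCombination ℚ u' f) := by
  refine Prod.ext ?_ ?_
  · exact Finsupp.apply_linearCombination ℚ (LinearMap.fst ℚ M M) _ f
  · exact Finsupp.apply_linearCombination ℚ (LinearMap.snd ℚ M M) _ f

/-- Adjoining a pair of orbits. -/
def adjoinOrbit (R : Submodule ℚ (M × M)) (u u' : ℤ → M) : Submodule ℚ (M × M) :=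
  R ⊔ Submodule.span ℚ (range fun k => (u k, u' k))

theorem mem_adjoinOrbit {R : Submodule ℚ (M × M)} {u u' : ℤ → M} {z : M × M} :
    z ∈ adjoinOrbit R u u' ↔ ∃ w ∈ R, ∃ f : ℤ →₀ ℚ,
      z = (w.1 + Finsupp.linearCombination ℚ u f, w.2 + Finsupp.linearCombination ℚ u' f) := by
  rw [adjoinOrbit, Submodule.mem_sup]
  constructor
  · rintro ⟨w, hw, t, ht, rfl⟩
    obtain ⟨f, rfl⟩ := (Finsupp.mem_span_range_iff_exists_finsupp).1 ht
    refine ⟨w, hw, f, ?_⟩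
    have := linearCombination_prod u u' f
    rw [Finsupp.linearCombination_apply] at this
    rw [this]
    rfl
  · rintro ⟨w, hw, f, rfl⟩
    refine ⟨w, hw, (Finsupp.linearCombination ℚ u f, Finsupp.linearCombination ℚ u' f), ?_, rfl⟩
    rw [← linearCombination_prod]
    exact Finsupp.mem_span_range_iff_exists_finsupp.2
      ⟨f, by rw [Finsupp.linearCombination_apply]⟩

theorem le_adjoinOrbit (R : Submodule ℚ (M × M)) (u u' : ℤ → M) : R ≤ adjoinOrbit R u u' :=
  le_sup_left

theorem orbit_mem_adjoinOrbit (R : Submodule ℚ (M × M)) (u u' : ℤ → M) (k : ℤ) :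
    (u k, u' k) ∈ adjoinOrbit R u u' :=
  le_sup_right (a := R) (Submodule.subset_span ⟨k, rfl⟩)

/-- `u` and `u'` realize corresponding cuts. -/
def SameCut (χ : M → M) (R : Submodule ℚ (M × M)) (x x' : M) : Prop :=
  ∀ z ∈ R, z.1 ∈ negImage χ → (z.1 < x → z.2 < x') ∧ (x < z.1 → x' < z.2)

/-- Going up uses discreteness: an element of `X` below `χ (u k)` is at most `u k`, and one above it
has a predecessor to which the induction hypothesis applies. Going down applies `χ` to the element
being compared. -/
theorem IsPartialIso.sameCut_orbit {χ : M → M} {c : M} {R : Submodule ℚ (M × M)}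
    (hχ : IsPdgGroup χ c) (hR : IsPartialIso χ c R) {u u' : ℤ → M} (hu : IsOrbit χ u)
    (hu' : IsOrbit χ u') (h0 : u 0 ∉ relDom R) (hcut : SameCut χ R (u 0) (u' 0)) (k : ℤ) :
    SameCut χ R (u k) (u' k) := by
  have hnot := hu.notMem (hR.isSubstructure_relDom hχ) h0
  induction k using Int.induction_on with
  | zero => exact hcut
  | succ k ih =>
    intro z hz hzX
    constructor
    · intro hlt
      have h1 : z.1 < u k := by
        by_contra! hc
        have hne : u k ≠ z.1 := fun e => hnot k (mem_relDom.2 ⟨z.2, e ▸ hz⟩)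
        exact hlt.not_ge ((hu k).2 ▸ hχ.succ _ (hu k).1 _ hzX (lt_of_le_of_ne hc hne))
      exact ((ih z hz hzX).1 h1).trans (hu'.strictMono hχ (by omega))
    · intro hlt
      have hc1 : c < z.1 := (hχ.least.2 (hu _).1).trans_lt hlt
      obtain ⟨y, hy, e⟩ := hχ.surj z.1 hzX hc1
      have hz2 := hR.image_mem hχ hz hzX
      obtain ⟨y', hy', e'⟩ := hχ.surj z.2 hz2 ((hR.lt_iff hR.c_mem hz).1 hc1)
      have hyy : (y, y') ∈ R := hR.pred y hy y' hy' (by rw [e, e']; exact hz)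
      rw [← e, (hu _).2] at hlt
      have h2 := (ih _ hyy hy).2 ((hχ.strictMonoOn.lt_iff_lt (hu _).1 hy).1 hlt)
      rw [← e', (hu' _).2]
      exact hχ.strictMonoOn (hu' _).1 hy' h2
  | pred k ih =>
    intro z hz hzX
    have hz2 := hR.image_mem hχ hz hzX
    have e : u (-k) = χ (u (-k - 1)) := by rw [← (hu _).2, sub_add_cancel]
    have e' : u' (-k) = χ (u' (-k - 1)) := by rw [← (hu' _).2, sub_add_cancel]
    have := ih _ (hR.chi z hz) (hχ.chi_mem_of_mem hzX)
    rw [e, e'] at this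
    simp only [hχ.strictMonoOn.lt_iff_lt (hu _).1 hzX, hχ.strictMonoOn.lt_iff_lt (hu' _).1 hz2,
      hχ.strictMonoOn.lt_iff_lt hzX (hu _).1, hχ.strictMonoOn.lt_iff_lt hz2 (hu' _).1] at this
    exact this

/-- In a sum of an old `w` and an orbit combination `S`, the value of `S` is some `u (k + 1)`. It is
not in the domain, so it differs from the value of `w`. The term of smaller value determines `χ`,
and `SameCut` ensures that it is the same term on both sides. -/
theorem IsPartialIso.adjoin_orbit {χ : M → M} {c : M} {R : Submodule ℚ (M × M)}
    (hχ : IsPdgGroup χ c) (hR : IsPartialIso χ c R) {u u' : ℤ → M} (hu : IsOrbit χ u)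
    (hu' : IsOrbit χ u') (h0 : u 0 ∉ relDom R) (hcut : SameCut χ R (u 0) (u' 0)) :
    IsPartialIso χ c (adjoinOrbit R u u') := by
  have hnot := hu.notMem (hR.isSubstructure_relDom hχ) h0
  have hcut := hR.sameCut_orbit hχ hu hu' h0 hcut
  refine hR.extend hχ (le_adjoinOrbit R u u') (range fun k => (u k, u' k)) ?_ ?_
  · rintro _ ⟨k, rfl⟩
    refine ⟨orbit_mem_adjoinOrbit R u u' k, (hu k).1, (hu' k).1, _, ⟨k - 1, rfl⟩, ?_, ?_⟩
    · rw [← (hu _).2, sub_add_cancel]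
    · rw [← (hu' _).2, sub_add_cancel]
  · intro z hz
    obtain ⟨w, hw, f, rfl⟩ := mem_adjoinOrbit.1 hz
    by_cases hf : f = 0
    · left
      exact ⟨w, hw, by simp [hf]⟩
    have hne : f.support.Nonempty := Finsupp.support_nonempty_iff.2 hf
    set k := f.support.min' hne with hk
    have hkm : k ∈ f.support := Finset.min'_mem _ _
    have hmin : ∀ j ∈ f.support, k ≤ j := fun j hj => Finset.min'_le _ _ hj
    have hfk : f k ≠ 0 := Finsupp.mem_support_iff.1 hkm
    have e := hu.chi_linearCombination hχ hkm hmin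
    have e' := hu'.chi_linearCombination hχ hkm hmin
    set S := Finsupp.linearCombination ℚ u f
    set S' := Finsupp.linearCombination ℚ u' f
    have v : val χ S = u (k + 1) := by
      rw [hχ.val_eq_of_chi_eq e, hχ.val_smul hfk, hu.val_eq hχ]
    have v' : val χ S' = u' (k + 1) := by
      rw [hχ.val_eq_of_chi_eq e', hχ.val_smul hfk, hu'.val_eq hχ]
    have right : χ (w.1 + S) = χ S → χ (w.2 + S') = χ S' →
        (∃ t ∈ range fun k => (u k, u' k), χ (w.1 + S) = t.1 ∧ χ (w.2 + S') = t.2) ∨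
          ∃ t ∈ range fun k => (u k, u' k), χ (w.1 + S) = -t.1 ∧ χ (w.2 + S') = -t.2 := by
      intro h1 h2
      rw [h1, h2, e, e']
      rcases lt_or_gt_of_ne hfk with hq | hq
      · right
        exact ⟨_, ⟨k + 1, rfl⟩, (hχ.chi_smul_neg hq _).trans (congrArg _ (hu k).2.symm),
          (hχ.chi_smul_neg hq _).trans (congrArg _ (hu' k).2.symm)⟩
      · left
        exact ⟨_, ⟨k + 1, rfl⟩, (hχ.chi_smul_pos hq _).trans (hu k).2.symm,
          (hχ.chi_smul_pos hq _).trans (hu' k).2.symm⟩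
    by_cases hw0 : w.1 = 0
    · have hw0' : w.2 = 0 := (hR.zero_iff hw).1 hw0
      exact Or.inr (right (by rw [hw0, zero_add]) (by rw [hw0', zero_add]))
    have hv := hR.val_mem hw
    have hvX := hχ.val_mem hw0
    rcases lt_trichotomy (val χ w.1) (u (k + 1)) with h1 | h1 | h1
    · left
      refine ⟨w, hw, hχ.chi_add_of_val_lt (by rwa [v]), hχ.chi_add_of_val_lt ?_⟩
      rw [v']
      exact (hcut _ _ hv hvX).1 h1
    · exact absurd (mem_relDom.2 ⟨_, h1 ▸ hv⟩) (hnot _)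
    · refine Or.inr (right ?_ ?_)
      · rw [add_comm]
        exact hχ.chi_add_of_val_lt (by rwa [v])
      · rw [add_comm]
        refine hχ.chi_add_of_val_lt ?_
        rw [v']
        exact (hcut _ _ hv hvX).2 h1

end PartialIso

/-! ### Saturation and the extension of partial isomorphisms. -/

section Saturated

variable {M : Type*} [AddCommGroup M] [LinearOrder M] [IsOrderedAddMonoid M] [Module ℚ M]

theorem countable_span {s : Set M} (hs : s.Countable) :
    (Submodule.span ℚ s : Set M).Countable := by
  have := hs.to_subtype
  have h : (Submodule.span ℚ s : Set M) = range (Finsupp.linearCombination ℚ ((↑) : s → M)) := by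
    rw [← LinearMap.coe_range, Finsupp.range_linearCombination, Subtype.range_coe]
  rw [h]
  exact countable_range _

theorem exists_countable_substructure {χ : M → M} {c : M} (hχ : IsPdgGroup χ c) {S : Set M}
    (hS : S.Countable) :
    ∃ A : Submodule ℚ M, IsSubstructure χ c A ∧ (A : Set M).Countable ∧ S ⊆ A := by
  let next : Submodule ℚ M → Submodule ℚ M := fun A =>
    Submodule.span ℚ ((A : Set M) ∪ χ '' A ∪ {x | x ∈ negImage χ ∧ χ x ∈ A})
  have hnext : ∀ A : Submodule ℚ M, (A : Set M).Countable → (next A : Set M).Countable := by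
    intro A hA
    refine countable_span ((hA.union (hA.image χ)).union ?_)
    -- Only countably many predecessors are added, because `χ` is injective on `X`.
    exact MapsTo.countable_of_injOn (f := χ) (t := (A : Set M)) (fun x hx => hx.2)
      (hχ.inj.mono fun x hx => hx.1) hA
  let A : ℕ → Submodule ℚ M := fun n => next^[n] (Submodule.span ℚ (insert c S))
  have hsucc : ∀ n, A (n + 1) = next (A n) := fun n => Function.iterate_succ_apply' next n _
  have hmono : Monotone A := monotone_nat_of_le_succ fun n x hx => by
    rw [hsucc]
    exact Submodule.subset_span (Or.inl (Or.inl hx))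
  have hmem : ∀ x, x ∈ ⨆ n, A n ↔ ∃ n, x ∈ A n :=
    fun x => Submodule.mem_iSup_of_directed A hmono.directed_le
  have hc : ∀ n, (A n : Set M).Countable := by
    intro n
    induction n with
    | zero => exact countable_span (hS.insert c)
    | succ n ih =>
      rw [hsucc]
      exact hnext _ ih
  refine ⟨⨆ n, A n, ⟨?_, ?_, ?_⟩, ?_, ?_⟩
  · intro a ha
    obtain ⟨n, hn⟩ := (hmem a).1 ha
    refine (hmem _).2 ⟨n + 1, ?_⟩
    rw [hsucc]
    exact Submodule.subset_span (Or.inl (Or.inr ⟨a, hn, rfl⟩))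
  · exact (hmem _).2 ⟨0, Submodule.subset_span (mem_insert _ _)⟩
  · intro x hx h
    obtain ⟨n, hn⟩ := (hmem _).1 h
    refine (hmem _).2 ⟨n + 1, ?_⟩
    rw [hsucc]
    exact Submodule.subset_span (Or.inr ⟨hx, hn⟩)
  · refine (countable_iUnion hc).mono fun x hx => ?_
    exact mem_iUnion.2 ((hmem x).1 hx)
  · intro x hx
    exact (hmem _).2 ⟨0, Submodule.subset_span (mem_insert_of_mem _ hx)⟩

/-- Predecessors of an element outside `A` stay outside `A`, so they never reach `c`, the only point
of `X` without predecessor. -/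
theorem IsSubstructure.exists_orbit {χ : M → M} {c : M} (hχ : IsPdgGroup χ c)
    {A : Submodule ℚ M} (hA : IsSubstructure χ c A) {x : M} (hx : x ∈ negImage χ) (hxA : x ∉ A) :
    ∃ u, IsOrbit χ u ∧ u 0 = x := by
  have hp : ∀ y : {y // y ∈ negImage χ ∧ y ∉ A}, ∃ z : {y // y ∈ negImage χ ∧ y ∉ A},
      χ z = y := by
    rintro ⟨y, hy, hyA⟩
    have hne : c ≠ y := fun e => hyA (e ▸ hA.c_mem)
    obtain ⟨z, hz, e⟩ := hχ.surj y hy (lt_of_le_of_ne (hχ.least.2 hy) hne)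
    exact ⟨⟨z, hz, fun hzA => hyA (e ▸ hA.chi z hzA)⟩, e⟩
  choose p hp using hp
  let u : ℤ → M
    | .ofNat n => χ^[n] x
    | .negSucc n => (p^[n + 1] ⟨x, hx, hxA⟩ : M)
  refine ⟨u, ?_, rfl⟩
  have hX : ∀ n : ℕ, χ^[n] x ∈ negImage χ := by
    intro n
    induction n with
    | zero => exact hx
    | succ n ih =>
      rw [Function.iterate_succ_apply']
      exact hχ.chi_mem_of_mem ih
  intro k
  rcases k with n | n
  · exact ⟨hX n, Function.iterate_succ_apply' χ n x⟩
  · refine ⟨(p^[n + 1] ⟨x, hx, hxA⟩).2.1, ?_⟩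
    rcases n with _ | n
    · exact (hp ⟨x, hx, hxA⟩).symm
    · change (p^[n + 1] ⟨x, hx, hxA⟩ : M) = χ (p^[n + 1 + 1] ⟨x, hx, hxA⟩ : M)
      rw [Function.iterate_succ_apply' p (n + 1), hp]

/-- The saturation needed for the back-and-forth argument. -/
structure IsSaturated (χ : M → M) : Prop where
  between : ∀ A B : Set M, A.Countable → B.Countable → (∀ a ∈ A, ∀ b ∈ B, a < b) →
    ∃ z, (∀ a ∈ A, a < z) ∧ ∀ b ∈ B, z < b
  balls : ∀ C : Set (M × M), C.Countable →
    (∀ F : Finset (M × M), (F : Set (M × M)) ⊆ C → ∃ y, ∀ z ∈ F, χ (y - z.1) = z.2) →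
    ∃ y, ∀ z ∈ C, χ (y - z.1) = z.2

theorem countable_adjoinOrbit {R : Submodule ℚ (M × M)} (hR : (R : Set (M × M)).Countable)
    (u u' : ℤ → M) : (adjoinOrbit R u u' : Set (M × M)).Countable := by
  have : Countable R := hR.to_subtype
  refine (countable_range fun p : R × (ℤ →₀ ℚ) => ((p.1.1.1 + Finsupp.linearCombination ℚ u p.2,
    p.1.1.2 + Finsupp.linearCombination ℚ u' p.2) : M × M)).mono fun z hz => ?_
  obtain ⟨w, hw, f, rfl⟩ := mem_adjoinOrbit.1 hz
  exact ⟨⟨⟨w, hw⟩, f⟩, rfl⟩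

theorem countable_sup_span_singleton {R : Submodule ℚ (M × M)}
    (hR : (R : Set (M × M)).Countable) (z : M × M) :
    ((R ⊔ Submodule.span ℚ {z} : Submodule ℚ (M × M)) : Set (M × M)).Countable := by
  have : Countable R := hR.to_subtype
  refine (countable_range fun p : R × ℚ => p.1.1 + p.2 • z).mono fun t ht => ?_
  obtain ⟨w, hw, s, hs, rfl⟩ := Submodule.mem_sup.1 ht
  obtain ⟨q, rfl⟩ := Submodule.mem_span_singleton.1 hs
  exact ⟨⟨⟨w, hw⟩, q⟩, rfl⟩

namespace IsPartialIso

variable {χ : M → M} {c : M} {R : Submodule ℚ (M × M)}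

/-- Saturation realizes the cut by some `z` that need not lie in `X`, so `χ z` is used instead. It
still lies below the upper part, because an element of that part has a second predecessor that is
also above `x`. -/
theorem exists_sameCut (hχ : IsPdgGroup χ c) (hs : IsSaturated χ) (hR : IsPartialIso χ c R)
    (hRc : (R : Set (M × M)).Countable) {x : M} (hx : x ∈ negImage χ) (hxR : x ∉ relDom R) :
    ∃ x' ∈ negImage χ, SameCut χ R x x' := by
  obtain ⟨z, hz1, hz2⟩ := hs.between (Prod.snd '' {z ∈ (R : Set (M × M)) | z.1 < x})
    (Prod.snd '' {z ∈ (R : Set (M × M)) | x < z.1}) ((hRc.mono (sep_subset _ _)).image _)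
    ((hRc.mono (sep_subset _ _)).image _) (by
      rintro _ ⟨a, ⟨ha, ha'⟩, rfl⟩ _ ⟨b, ⟨hb, hb'⟩, rfl⟩
      exact (hR.lt_iff ha hb).1 (ha'.trans hb'))
  have hz0 : z < 0 := hz2 0 ⟨0, ⟨R.zero_mem, hχ.neg_of_mem hx⟩, rfl⟩
  have step : ∀ b ∈ R, b.1 ∈ negImage χ → x < b.1 →
      ∃ d ∈ R, d.1 ∈ negImage χ ∧ d.2 ∈ negImage χ ∧ x < d.1 ∧ χ d.2 = b.2 := by
    intro b hb hbX hxb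
    have hcb := (hχ.least.2 hx).trans_lt hxb
    obtain ⟨d, hd, e⟩ := hχ.surj _ hbX hcb
    obtain ⟨d', hd', e'⟩ := hχ.surj _ (hR.image_mem hχ hb hbX) ((hR.lt_iff hR.c_mem hb).1 hcb)
    have hdd : (d, d') ∈ R := hR.pred d hd d' hd' (by rw [e, e']; exact hb)
    refine ⟨_, hdd, hd, hd', lt_of_le_of_ne ?_ ?_, e'⟩
    · by_contra! hc
      exact hxb.not_ge (e ▸ hχ.succ _ hd _ hx hc)
    · rintro rfl
      exact hxR (mem_relDom.2 ⟨d', hdd⟩)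
  refine ⟨χ z, hχ.chi_mem hz0, fun a ha haX => ⟨fun hlt => ?_, fun hlt => ?_⟩⟩
  · exact (hz1 _ ⟨a, ⟨ha, hlt⟩, rfl⟩).trans (hχ.lt_chi z hz0)
  · obtain ⟨d, hd, hdX, hdX', hxd, e⟩ := step a ha haX hlt
    obtain ⟨t, ht, -, -, hxt, e'⟩ := step d hd hdX hxd
    calc χ z ≤ χ t.2 := hχ.mono (hz2 _ ⟨t, ⟨ht, hxt⟩, rfl⟩).le
      _ = d.2 := e'
      _ < χ d.2 := hχ.lt_chi_of_mem hdX'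
      _ = a.2 := e

theorem exists_orbit_sameCut (hχ : IsPdgGroup χ c) (hs : IsSaturated χ)
    (hR : IsPartialIso χ c R) (hRc : (R : Set (M × M)).Countable) {x : M}
    (hx : x ∈ negImage χ) (hxR : x ∉ relDom R) :
    ∃ u', IsOrbit χ u' ∧ SameCut χ R x (u' 0) := by
  obtain ⟨x', hx', hcut⟩ := hR.exists_sameCut hχ hs hRc hx hxR
  -- If `x'` had a preimage `a`, then `a ≠ x`, and comparing the two would give `x' < x'`.
  obtain ⟨u', hu', rfl⟩ := (hR.swap.isSubstructure_relDom hχ).exists_orbit hχ hx' (fun h => by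
    obtain ⟨a, ha⟩ := mem_relDom.1 h
    have haX := hR.swap.image_mem hχ ha hx'
    rcases lt_trichotomy a x with h1 | h1 | h1
    · exact lt_irrefl _ ((hcut _ ha haX).1 h1)
    · exact hxR (mem_relDom.2 ⟨_, h1 ▸ ha⟩)
    · exact lt_irrefl _ ((hcut _ ha haX).2 h1))
  exact ⟨u', hu', hcut⟩

theorem relDom_adjoinOrbit_le {u : ℤ → M} (hu : IsOrbit χ u) (u' : ℤ → M) {A : Submodule ℚ M}
    (hA : IsSubstructure χ c A) (hRA : relDom R ≤ A) (h0 : u 0 ∈ A) :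
    relDom (adjoinOrbit R u u') ≤ A := by
  intro a ha
  obtain ⟨a', ha⟩ := mem_relDom.1 ha
  obtain ⟨w, hw, f, e⟩ := mem_adjoinOrbit.1 ha
  have e1 : a = _ := (Prod.ext_iff.1 e).1
  rw [e1]
  refine A.add_mem (hRA (mem_relDom.2 ⟨_, hw⟩)) ?_
  rw [Finsupp.linearCombination_apply]
  exact A.sum_mem fun k _ => A.smul_mem _ ((hu.mem_iff hA k).2 h0)

theorem iSup (R : ℕ → Submodule ℚ (M × M)) (hmono : Monotone R)
    (hR : ∀ n, IsPartialIso χ c (R n)) : IsPartialIso χ c (⨆ n, R n) := by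
  have hmem : ∀ x, x ∈ ⨆ n, R n ↔ ∃ n, x ∈ R n :=
    fun x => Submodule.mem_iSup_of_directed R hmono.directed_le
  refine ⟨?_, ?_, (hmem _).2 ⟨0, (hR 0).c_mem⟩, ?_⟩
  · intro z hz
    obtain ⟨n, hn⟩ := (hmem z).1 hz
    exact (hR n).pos z hn
  · intro z hz
    obtain ⟨n, hn⟩ := (hmem z).1 hz
    exact (hmem _).2 ⟨n, (hR n).chi z hn⟩
  · intro x hx x' hx' hz
    obtain ⟨n, hn⟩ := (hmem _).1 hz
    exact (hmem _).2 ⟨n, (hR n).pred x hx x' hx' hn⟩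

/-- Extending a partial isomorphism to all elements of `χ(Γ^{<0})` in a substructure. -/
theorem exists_extend_image (hχ : IsPdgGroup χ c) (hs : IsSaturated χ)
    (hR : IsPartialIso χ c R) (hRc : (R : Set (M × M)).Countable) {A : Submodule ℚ M}
    (hA : IsSubstructure χ c A) (hAc : (A : Set M).Countable) (hRA : relDom R ≤ A) :
    ∃ R' : Submodule ℚ (M × M), R ≤ R' ∧ IsPartialIso χ c R' ∧ (R' : Set (M × M)).Countable ∧
      relDom R' ≤ A ∧ ∀ x ∈ negImage χ, x ∈ A → x ∈ relDom R' := by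
  obtain ⟨e, he⟩ := (hAc.mono (inter_subset_right (s := negImage χ))).exists_eq_range
    ⟨c, hχ.least.1, hA.c_mem⟩
  have heX : ∀ n, e n ∈ negImage χ ∩ A := fun n => he ▸ mem_range_self n
  let T := {R' : Submodule ℚ (M × M) // IsPartialIso χ c R' ∧ (R' : Set (M × M)).Countable ∧
    relDom R' ≤ A}
  have step : ∀ (n : ℕ) (R₁ : T), ∃ R₂ : T, R₁.1 ≤ R₂.1 ∧ e n ∈ relDom R₂.1 := by
    rintro n ⟨R₁, h1, h2, h3⟩
    by_cases hn : e n ∈ relDom R₁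
    · exact ⟨⟨R₁, h1, h2, h3⟩, le_rfl, hn⟩
    obtain ⟨u, hu, e0⟩ := (h1.isSubstructure_relDom hχ).exists_orbit hχ (heX n).1 hn
    obtain ⟨u', hu', hcut⟩ := h1.exists_orbit_sameCut hχ hs h2 (heX n).1 hn
    rw [← e0] at hn hcut
    refine ⟨⟨adjoinOrbit R₁ u u', h1.adjoin_orbit hχ hu hu' hn hcut,
      countable_adjoinOrbit h2 u u', relDom_adjoinOrbit_le hu u' hA h3 (e0 ▸ (heX n).2)⟩,
      le_adjoinOrbit _ _ _, mem_relDom.2 ⟨u' 0, ?_⟩⟩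
    have := orbit_mem_adjoinOrbit R₁ u u' 0
    rwa [e0] at this
  choose next hnext using step
  let Q : ℕ → T := fun n => Nat.rec ⟨R, hR, hRc, hRA⟩ (fun n R₁ => next n R₁) n
  have hQ : ∀ n, Q (n + 1) = next n (Q n) := fun n => rfl
  have hmono : Monotone fun n => (Q n).1 := monotone_nat_of_le_succ fun n => by
    rw [hQ]
    exact (hnext n (Q n)).1
  have hmem : ∀ x, x ∈ ⨆ n, (Q n).1 ↔ ∃ n, x ∈ (Q n).1 :=
    fun x => Submodule.mem_iSup_of_directed _ hmono.directed_le
  refine ⟨⨆ n, (Q n).1, le_iSup (fun n => (Q n).1) 0,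
    iSup _ hmono fun n => (Q n).2.1, ?_, ?_, ?_⟩
  · refine (countable_iUnion fun n => (Q n).2.2.1).mono fun x hx => ?_
    exact mem_iUnion.2 ((hmem x).1 hx)
  · intro a ha
    obtain ⟨a', ha⟩ := mem_relDom.1 ha
    obtain ⟨n, hn⟩ := (hmem _).1 ha
    exact (Q n).2.2.2 (mem_relDom.2 ⟨a', hn⟩)
  · intro x hx hxA
    obtain ⟨n, rfl⟩ : x ∈ range e := he ▸ ⟨hx, hxA⟩
    obtain ⟨a', ha⟩ := mem_relDom.1 (hnext n (Q n)).2
    exact mem_relDom.2 ⟨a', (hmem _).2 ⟨n + 1, ha⟩⟩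

end IsPartialIso

namespace IsPdgGroup

variable {χ : M → M} {c : M} (hχ : IsPdgGroup χ c)
include hχ

theorem val_eq_neg_abs (a : M) : val χ a = -|χ a| := by
  rcases lt_trichotomy a 0 with ha | rfl | ha
  · rw [hχ.val_of_neg ha, abs_of_neg (hχ.chi_neg a ha), neg_neg]
  · simp [hχ.val_zero, hχ.zero]
  · rw [hχ.val_of_pos ha, abs_of_pos (hχ.chi_pos ha)]

/-- There is no cancellation between nonnegative terms, so the sum has the smaller of the two
values. -/
theorem chi_add_of_nonneg {p q : M} (hp : 0 ≤ p) (hq : 0 < q) (hpq : val χ q ≤ val χ p) :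
    χ (p + q) = χ q := by
  refine le_antisymm ?_ (hχ.mono (le_add_of_nonneg_left hp))
  have h1 := hχ.min_val_le_val_add p q
  rw [min_eq_right hpq, hχ.val_of_pos hq, hχ.val_of_pos (add_pos_of_nonneg_of_pos hp hq)] at h1
  exact neg_le_neg_iff.1 h1

/-- Helly-type statement for finitely many fibres of translates of `χ`. -/
theorem exists_chi_sub_eq {R : Submodule ℚ (M × M)} (hR : IsPartialIso χ c R) {y : M}
    (hy : y ∉ relDom R) (F : Finset ((M × M) × (M × M)))
    (hF : ∀ p ∈ F, p.1 ∈ R ∧ p.2 ∈ R ∧ χ (y - p.1.1) = p.2.1) :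
    ∃ y', ∀ p ∈ F, χ (y' - p.1.2) = p.2.2 := by
  classical
  rcases F.eq_empty_or_nonempty with rfl | hne
  · exact ⟨0, by simp⟩
  -- `p₀` gives a centre closest to `y`, and `u` is the value of its distance to `y`. Only the
  -- centres at that distance matter; the other conditions will follow from the one for `p₀`.
  obtain ⟨p₀, hp₀, hmax⟩ := F.exists_max_image (fun p => val χ (y - p.1.1)) hne
  obtain ⟨hR₀, hw₀, e₀⟩ := hF p₀ hp₀
  set u := val χ (y - p₀.1.1) with hu
  set u' := -|p₀.2.2| with hu'
  have hne0 : ∀ p ∈ F, p.1.1 ≠ y := fun p hp e => hy (mem_relDom.2 ⟨p.1.2, e ▸ (hF p hp).1⟩)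
  have huX : u ∈ negImage χ := hχ.val_mem (sub_ne_zero.2 (hne0 p₀ hp₀).symm)
  have huR : (u, u') ∈ R := by
    rw [hu, hχ.val_eq_neg_abs, e₀, hu']
    rcases lt_or_ge p₀.2.1 0 with h | h
    · rwa [abs_of_neg h, abs_of_neg ((hR.neg_iff hw₀).1 h), neg_neg, neg_neg]
    · have h' : 0 ≤ p₀.2.2 := by
        rw [← not_lt] at h ⊢
        rwa [← hR.neg_iff hw₀]
      rw [abs_of_nonneg h, abs_of_nonneg h']
      exact R.neg_mem hw₀
  -- `-s` is a positive length of value `u'`, used as a gap when all closest centres are on one side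
  -- of `y`.
  obtain ⟨s, hs, hsu⟩ := hR.image_mem hχ huR huX
  have hs : s < 0 := hs
  have hs' : 0 < -s := neg_pos.2 hs
  have hsv : val χ (-s) = u' := by rw [hχ.val_neg, hχ.val_of_neg hs, hsu]
  have tr : ∀ z ∈ R, u ≤ val χ z.1 → u' ≤ val χ z.2 := by
    intro z hz h
    by_contra! hc
    exact h.not_gt ((hR.lt_iff (hR.val_mem hz) huR).2 hc)
  have tr' : ∀ z ∈ R, val χ z.1 = u → val χ z.2 = u' := fun z hz h =>
    (hR.eq_iff (hR.val_mem hz) huR).1 h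
  set F₁ := F.filter fun p => val χ (y - p.1.1) = u with hF₁
  have mem₁ : ∀ p ∈ F₁, p.1 ∈ R ∧ val χ (y - p.1.1) = u := fun p hp =>
    ⟨(hF p (Finset.mem_filter.1 hp).1).1, (Finset.mem_filter.1 hp).2⟩
  have close : ∀ p ∈ F₁, ∀ q ∈ F₁, u' ≤ val χ (p.1.2 - q.1.2) := by
    intro p hp q hq
    refine tr _ (R.sub_mem (mem₁ p hp).1 (mem₁ q hq).1) ?_
    have := hχ.min_val_le_val_add (y - q.1.1) (-(y - p.1.1))
    rw [hχ.val_neg, (mem₁ p hp).2, (mem₁ q hq).2, min_self] at this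
    convert this using 2
    simp only [Prod.fst_sub]
    abel
  set Lo := F₁.filter fun p => p.1.1 < y with hLo
  set Up := F₁.filter fun p => y < p.1.1 with hUp
  have memL : ∀ p ∈ Lo, p ∈ F₁ ∧ p.1.1 < y := fun p hp => Finset.mem_filter.1 hp
  have memU : ∀ p ∈ Up, p ∈ F₁ ∧ y < p.1.1 := fun p hp => Finset.mem_filter.1 hp
  -- `l` and `r` are the images of the innermost closest centres on either side of `y`, or are made
  -- up with `-s`.
  obtain ⟨l, r, hlr, hlrv, hl, hr⟩ : ∃ l r : M, l < r ∧ val χ (r - l) = u' ∧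
      (∀ p ∈ Lo, p.1.2 ≤ l ∧ u' ≤ val χ (l - p.1.2)) ∧
      ∀ p ∈ Up, r ≤ p.1.2 ∧ u' ≤ val χ (p.1.2 - r) := by
    have exL : Lo.Nonempty → ∃ p ∈ Lo, ∀ q ∈ Lo, q.1.2 ≤ p.1.2 ∧ u' ≤ val χ (p.1.2 - q.1.2) := by
      intro h
      obtain ⟨p, hp, hpm⟩ := Lo.exists_max_image (fun p => p.1.2) h
      exact ⟨p, hp, fun q hq => ⟨hpm q hq, close _ (memL p hp).1 _ (memL q hq).1⟩⟩
    have exU : Up.Nonempty → ∃ p ∈ Up, ∀ q ∈ Up, p.1.2 ≤ q.1.2 ∧ u' ≤ val χ (q.1.2 - p.1.2) := by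
      intro h
      obtain ⟨p, hp, hpm⟩ := Up.exists_min_image (fun p => p.1.2) h
      exact ⟨p, hp, fun q hq => ⟨hpm q hq, close _ (memU q hq).1 _ (memU p hp).1⟩⟩
    rcases Lo.eq_empty_or_nonempty with hL | hL <;> rcases Up.eq_empty_or_nonempty with hU | hU
    · exact ⟨0, -s, hs', by rwa [sub_zero], by simp [hL], by simp [hU]⟩
    · obtain ⟨p, hp, hpm⟩ := exU hU
      refine ⟨p.1.2 - -s, p.1.2, sub_lt_self _ hs', ?_, by simp [hL], hpm⟩
      rwa [sub_sub_cancel]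
    · obtain ⟨p, hp, hpm⟩ := exL hL
      refine ⟨p.1.2, p.1.2 + -s, lt_add_of_pos_right _ hs', ?_, hpm, by simp [hU]⟩
      rwa [add_sub_cancel_left]
    · obtain ⟨p, hp, hpm⟩ := exL hL
      obtain ⟨q, hq, hqm⟩ := exU hU
      obtain ⟨hp1, hp2⟩ := memL p hp
      obtain ⟨hq1, hq2⟩ := memU q hq
      refine ⟨p.1.2, q.1.2, (hR.lt_iff (mem₁ p hp1).1 (mem₁ q hq1).1).1 (hp2.trans hq2), ?_,
        hpm, hqm⟩
      refine tr' _ (R.sub_mem (mem₁ q hq1).1 (mem₁ p hp1).1) ?_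
      have h1 : val χ (q.1.1 - y) = u := by
        rw [← hχ.val_neg, neg_sub, (mem₁ q hq1).2]
      have := hχ.chi_add_of_nonneg (sub_pos.2 hq2).le (sub_pos.2 hp2)
        (by rw [h1, (mem₁ p hp1).2])
      rw [sub_add_sub_cancel] at this
      exact (hχ.val_eq_of_chi_eq this).trans (mem₁ p hp1).2
  -- The midpoint `l + t` is the solution: it lies on the correct side of every closest centre, at
  -- distance of value exactly `u'`.
  set t := (2⁻¹ : ℚ) • (r - l) with ht
  have htpos : 0 < t := by
    rw [← hχ.chi_pos_iff, ht, hχ.chi_smul_pos (by norm_num), hχ.chi_pos_iff]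
    exact sub_pos.2 hlr
  have htv : val χ t = u' := by rw [ht, hχ.val_smul (by norm_num), hlrv]
  have htt : r = l + t + t := by
    have : t + t = r - l := by
      rw [ht, ← add_smul]
      norm_num
    rw [add_assoc, this]
    abel
  have hchit : χ t = -u' := by rw [← htv, hχ.val_of_pos htpos, neg_neg]
  have done₁ : ∀ p ∈ F₁, χ (l + t - p.1.2) = p.2.2 := by
    intro p hp
    obtain ⟨-, hpw, hpe⟩ := hF p (Finset.mem_filter.1 hp).1
    have hpv := (mem₁ p hp).2
    rcases lt_or_gt_of_ne (hne0 p (Finset.mem_filter.1 hp).1) with h | h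
    · obtain ⟨h1, h2⟩ := hl p (Finset.mem_filter.2 ⟨hp, h⟩)
      have := hχ.chi_add_of_nonneg (sub_nonneg.2 h1) htpos (by rwa [htv])
      rw [show l + t - p.1.2 = l - p.1.2 + t by abel, this, hchit]
      refine (hR.eq_iff (R.neg_mem huR) hpw).1 ?_
      rw [← hpe, ← hpv, hχ.val_of_pos (sub_pos.2 h), neg_neg]
    · obtain ⟨h1, h2⟩ := hr p (Finset.mem_filter.2 ⟨hp, h⟩)
      have := hχ.chi_add_of_nonneg (sub_nonneg.2 h1) htpos (by rwa [htv])
      rw [show l + t - p.1.2 = -(p.1.2 - r + t) by rw [htt]; abel, hχ.neg, this, hchit, neg_neg]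
      refine (hR.eq_iff huR hpw).1 ?_
      rw [← hpe, ← hpv, hχ.val_of_neg (sub_neg.2 h)]
  refine ⟨l + t, fun p hp => ?_⟩
  by_cases hpv : val χ (y - p.1.1) = u
  · exact done₁ p (Finset.mem_filter.2 ⟨hp, hpv⟩)
  obtain ⟨hpR, hpw, hpe⟩ := hF p hp
  have hlt : val χ (y - p.1.1) < u := lt_of_le_of_ne (hmax p hp) hpv
  have h0 := done₁ p₀ (Finset.mem_filter.2 ⟨hp₀, rfl⟩)
  have hv0 : val χ (l + t - p₀.1.2) = u' := by rw [hχ.val_eq_neg_abs, h0]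
  -- From a more distant centre, `y` and the centre of `p₀` look the same under `χ`; the relation
  -- carries this over to the images.
  have h1 : χ (p₀.1.1 - p.1.1) = χ (y - p.1.1) := by
    have := hχ.chi_add_of_val_lt (a := y - p.1.1) (b := -(y - p₀.1.1)) (by rwa [hχ.val_neg])
    rw [← this]
    congr 1
    abel
  have hsub : (p₀.1.1 - p.1.1, p₀.1.2 - p.1.2) ∈ R := R.sub_mem hR₀ hpR
  have h2 : χ (p₀.1.2 - p.1.2) = p.2.2 :=
    (hR.eq_iff (hR.chi _ hsub) hpw).1 (h1.trans hpe)
  have h3 : val χ (p₀.1.2 - p.1.2) < val χ (l + t - p₀.1.2) := by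
    rw [hv0]
    refine (hR.lt_iff (hR.val_mem hsub) huR).1 ?_
    rwa [hχ.val_eq_of_chi_eq h1]
  rw [← h2, ← hχ.chi_add_of_val_lt h3]
  congr 1
  abel

end IsPdgGroup

/-- The forth property; the back property follows by symmetry. -/
theorem IsPartialIso.exists_extend {χ : M → M} {c : M} {R : Submodule ℚ (M × M)}
    (hχ : IsPdgGroup χ c) (hs : IsSaturated χ) (hR : IsPartialIso χ c R)
    (hRc : (R : Set (M × M)).Countable) (y : M) :
    ∃ R' : Submodule ℚ (M × M), R ≤ R' ∧ IsPartialIso χ c R' ∧ (R' : Set (M × M)).Countable ∧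
      ∃ y', (y, y') ∈ R' := by
  classical
  have hdc : (relDom R : Set M).Countable := by
    refine (hRc.image Prod.fst).mono fun a ha => ?_
    obtain ⟨a', ha⟩ := mem_relDom.1 ha
    exact ⟨_, ha, rfl⟩
  -- Once all of `X ∩ A` is in the domain, every `χ (y - a)` with `a` in the domain is already
  -- there, so `y` can be adjoined without new values.
  obtain ⟨A, hA, hAc, hRA⟩ := exists_countable_substructure hχ (hdc.insert y)
  obtain ⟨R₁, hle, hR₁, hR₁c, hR₁A, hX⟩ := hR.exists_extend_image hχ hs hRc hA hAc
    fun a ha => hRA (mem_insert_of_mem _ ha)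
  by_cases hy : y ∈ relDom R₁
  · exact ⟨R₁, hle, hR₁, hR₁c, mem_relDom.1 hy⟩
  have hchi : ∀ z ∈ R₁, ∃ w, (χ (y - z.1), w) ∈ R₁ := by
    intro z hz
    have hzA : y - z.1 ∈ A := A.sub_mem (hRA (mem_insert _ _)) (hR₁A (mem_relDom.2 ⟨_, hz⟩))
    have hne : y - z.1 ≠ 0 := fun e => hy (mem_relDom.2 ⟨z.2, sub_eq_zero.1 e ▸ hz⟩)
    have hvA : val χ (y - z.1) ∈ A := by
      rw [hχ.val_eq_neg_abs]
      have := hA.chi _ hzA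
      rcases abs_choice (χ (y - z.1)) with h | h
      · rw [h]; exact A.neg_mem this
      · rwa [h, neg_neg]
    obtain ⟨w, hw⟩ := mem_relDom.1 (hX _ (hχ.val_mem hne) hvA)
    rcases hχ.chi_eq_val_or (y - z.1) with h | h
    · exact ⟨w, h ▸ hw⟩
    · exact ⟨-w, h ▸ R₁.neg_mem hw⟩
  obtain ⟨y', hy'⟩ := hs.balls ((fun p : (M × M) × (M × M) => (p.1.2, p.2.2)) ''
      {p ∈ (R₁ : Set (M × M)) ×ˢ (R₁ : Set (M × M)) | χ (y - p.1.1) = p.2.1})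
    (((hR₁c.prod hR₁c).mono (sep_subset _ _)).image _) (by
      intro F hF
      obtain ⟨F', hF', rfl⟩ := Finset.subset_set_image_iff.1 hF
      obtain ⟨y', hy'⟩ := hχ.exists_chi_sub_eq hR₁ hy F' fun p hp =>
        ⟨(hF' hp).1.1, (hF' hp).1.2, (hF' hp).2⟩
      refine ⟨y', fun z hz => ?_⟩
      obtain ⟨p, hp, rfl⟩ := Finset.mem_image.1 hz
      exact hy' p hp)
  refine ⟨R₁ ⊔ Submodule.span ℚ {(y, y')}, hle.trans le_sup_left,
    hR₁.extend_singleton hχ fun z hz => ?_, countable_sup_span_singleton hR₁c _, y',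
    le_sup_right (a := R₁) (Submodule.mem_span_singleton_self _)⟩
  obtain ⟨w, hw⟩ := hchi z hz
  have := hy' (z.2, w) ⟨(z, (χ (y - z.1), w)), ⟨⟨hz, hw⟩, rfl⟩, rfl⟩
  simp only at this
  rwa [this]

end Saturated

/-! ### Moving elements outside a countable substructure. -/

section Move

variable {M : Type*} [AddCommGroup M] [LinearOrder M] [IsOrderedAddMonoid M] [Module ℚ M]

theorem IsSubstructure.chi_mem_iff_val_mem {χ : M → M} {c : M} (hχ : IsPdgGroup χ c)
    {A : Submodule ℚ M} {a : M} : χ a ∈ A ↔ val χ a ∈ A := by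
  rcases hχ.chi_eq_val_or a with h | h
  · rw [h]
  · rw [h, A.neg_mem_iff]

/-- Nothing in `A ∩ X` separates `x` from its immediate successor, which is itself outside `A`. This
permits shifting an orbit by one step. -/
theorem IsSubstructure.sameCut_succ {χ : M → M} {c : M} (hχ : IsPdgGroup χ c)
    {A : Submodule ℚ M} (hA : IsSubstructure χ c A) {x : M} (hx : x ∈ negImage χ) (hxA : x ∉ A) :
    SameCut χ (diag A) x (χ x) := by
  intro z hz hzX
  obtain ⟨h1, h2⟩ := mem_diag.1 hz
  rw [← h2]
  refine ⟨fun h => h.trans (hχ.lt_chi_of_mem hx), fun h => ?_⟩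
  refine lt_of_le_of_ne (hχ.succ x hx _ hzX h) fun e => hxA (hA.pred x hx (e ▸ h1))

theorem relDom_diag (A : Submodule ℚ M) : relDom (diag A) = A := by
  ext a
  rw [mem_relDom]
  exact ⟨fun ⟨_, h⟩ => (mem_diag.1 h).1, fun h => ⟨a, mem_diag.2 ⟨h, rfl⟩⟩⟩

theorem countable_diag {A : Submodule ℚ M} (hA : (A : Set M).Countable) :
    (diag A : Set (M × M)).Countable :=
  (hA.image fun a => ((a, a) : M × M)).mono fun z hz =>
    show z ∈ (fun a : M => ((a, a) : M × M)) '' A from ⟨z.1, (mem_diag.1 hz).1, Prod.ext rfl (mem_diag.1 hz).2⟩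

theorem diag_mono {A B : Submodule ℚ M} (h : A ≤ B) : diag A ≤ diag B := Submodule.map_mono h

/-- An element outside of a countable substructure is moved by a partial isomorphism fixing the
substructure. -/
theorem IsSubstructure.exists_move {χ : M → M} {c : M} (hχ : IsPdgGroup χ c)
    (hs : IsSaturated χ) {A : Submodule ℚ M} (hA : IsSubstructure χ c A)
    (hAc : (A : Set M).Countable) {y : M} (hy : y ∉ A) :
    ∃ R : Submodule ℚ (M × M), diag A ≤ R ∧ IsPartialIso χ c R ∧ (R : Set (M × M)).Countable ∧
      ∃ y', y' ≠ y ∧ (y, y') ∈ R := by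
  obtain ⟨C, hC, hCc, hAC⟩ := exists_countable_substructure hχ (hAc.insert y)
  have hAC' : A ≤ C := fun a ha => hAC (mem_insert_of_mem _ ha)
  have hyC : y ∈ C := hAC (mem_insert _ _)
  -- `B` is maximal among the substructures of `C` containing `A` but not `y`.
  obtain ⟨B, hAB, hB⟩ := zorn_le_nonempty₀ {B | IsSubstructure χ c B ∧ B ≤ C ∧ y ∉ B} (by
    intro S hS hchain B₀ hB₀
    have hmem : ∀ x, x ∈ sSup S ↔ ∃ B ∈ S, x ∈ B :=
      fun x => Submodule.mem_sSup_of_directed ⟨B₀, hB₀⟩ hchain.directedOn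
    refine ⟨sSup S, ⟨⟨?_, ?_, ?_⟩, ?_, ?_⟩, fun B hB => le_sSup hB⟩
    · intro a ha
      obtain ⟨B, hB, h⟩ := (hmem a).1 ha
      exact (hmem _).2 ⟨B, hB, (hS hB).1.chi a h⟩
    · exact (hmem _).2 ⟨B₀, hB₀, (hS hB₀).1.c_mem⟩
    · intro x hx h
      obtain ⟨B, hB, h⟩ := (hmem _).1 h
      exact (hmem _).2 ⟨B, hB, (hS hB).1.pred x hx h⟩
    · exact sSup_le fun B hB => (hS hB).2.1
    · intro h
      obtain ⟨B, hB, h⟩ := (hmem _).1 h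
      exact (hS hB).2.2 h) A ⟨hA, hAC', hy⟩
  obtain ⟨hBs, hBC, hyB⟩ := hB.prop
  have hBc : (B : Set M).Countable := hCc.mono hBC
  have hBd := hBs.isPartialIso_diag hχ
  by_cases hX : ∀ x ∈ negImage χ, x ∈ C → x ∈ B
  -- When `C` has no new elements of `X`, `y` is moved to `y + z` with `z` so small that no `χ (y -
  -- b)` changes.
  · obtain ⟨z, hz1, hz2⟩ := hs.between (negImage χ ∩ C) {0} (hCc.mono inter_subset_right)
      (countable_singleton 0) (by
        rintro a ⟨ha, -⟩ b rfl
        exact hχ.neg_of_mem ha)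
    have hz0 : z < 0 := hz2 0 rfl
    have hvC : ∀ b ∈ B, val χ (y - b) ∈ negImage χ ∩ C := by
      intro b hb
      have hne : y - b ≠ 0 := fun e => hyB (sub_eq_zero.1 e ▸ hb)
      exact ⟨hχ.val_mem hne, (IsSubstructure.chi_mem_iff_val_mem hχ).1
        (hC.chi _ (C.sub_mem hyC (hBC hb)))⟩
    refine ⟨diag B ⊔ Submodule.span ℚ {(y, y + z)}, (diag_mono hAB).trans le_sup_left,
      hBd.extend_singleton hχ ?_, countable_sup_span_singleton (countable_diag hBc) _, y + z, ?_,
      le_sup_right (a := diag B) (Submodule.mem_span_singleton_self _)⟩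
    · intro w hw
      obtain ⟨h1, h2⟩ := mem_diag.1 hw
      have hv := hvC _ h1
      refine mem_diag.2 ⟨(IsSubstructure.chi_mem_iff_val_mem hχ).2 (hX _ hv.1 hv.2), ?_⟩
      rw [← h2, add_sub_right_comm]
      refine (hχ.chi_add_of_val_lt ?_).symm
      rw [hχ.val_of_neg hz0]
      exact (hz1 _ hv).trans (hχ.lt_chi z hz0)
    · simpa using hz0.ne
  · push Not at hX
    obtain ⟨x, hx, hxC, hxB⟩ := hX
    obtain ⟨u, hu, rfl⟩ := hBs.exists_orbit hχ hx hxB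
    -- Otherwise the shift of a new orbit is used. By maximality `y` lies in `B` plus the span of
    -- the orbit, and the shift changes the value of its nonzero orbit part.
    set u' : ℤ → M := fun k => u (k + 1) with hu'
    have hou' : IsOrbit χ u' := fun k => hu (k + 1)
    have hcut : SameCut χ (diag B) (u 0) (u' 0) := by
      change SameCut χ (diag B) (u 0) (u (0 + 1))
      rw [(hu 0).2]
      exact hBs.sameCut_succ hχ hx hxB
    have h0 : u 0 ∉ relDom (diag B) := by rwa [relDom_diag]
    have hR : ∀ v, IsOrbit χ v → SameCut χ (diag B) (u 0) (v 0) →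
        IsPartialIso χ c (adjoinOrbit (diag B) u v) := fun v hv hc =>
      hBd.adjoin_orbit hχ hu hv h0 hc
    have hyB' : y ∈ relDom (adjoinOrbit (diag B) u u') := by
      by_contra hc
      refine hxB (hB.le_of_ge (y := relDom (adjoinOrbit (diag B) u u'))
        ⟨(hR u' hou' hcut).isSubstructure_relDom hχ, ?_, hc⟩ ?_
        (mem_relDom.2 ⟨_, orbit_mem_adjoinOrbit _ _ _ 0⟩))
      · exact IsPartialIso.relDom_adjoinOrbit_le hu u' hC (by rwa [relDom_diag]) hxC
      · intro b hb
        exact mem_relDom.2 ⟨b, le_adjoinOrbit _ _ _ (mem_diag.2 ⟨hb, rfl⟩)⟩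
    obtain ⟨y', hy'⟩ := mem_relDom.1 hyB'
    refine ⟨_, (diag_mono hAB).trans (le_adjoinOrbit _ _ _), hR u' hou' hcut,
      countable_adjoinOrbit (countable_diag hBc) _ _, y', ?_, hy'⟩
    rintro rfl
    obtain ⟨w, hw, f, e⟩ := mem_adjoinOrbit.1 hy'
    obtain ⟨e1, e2⟩ := Prod.ext_iff.1 e
    obtain ⟨hw1, hw2⟩ := mem_diag.1 hw
    simp only at e1 e2
    have hf : f ≠ 0 := by
      rintro rfl
      exact hyB (by simpa [e1] using hw1)
    have heq : Finsupp.linearCombination ℚ u f = Finsupp.linearCombination ℚ u' f := by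
      rw [← hw2, e1] at e2
      exact add_left_cancel e2
    have hne : f.support.Nonempty := Finsupp.support_nonempty_iff.2 hf
    have hkm := Finset.min'_mem _ hne
    have hmin : ∀ j ∈ f.support, f.support.min' hne ≤ j := fun j hj => Finset.min'_le _ _ hj
    have hfk := Finsupp.mem_support_iff.1 hkm
    have h1 := hχ.val_eq_of_chi_eq (hu.chi_linearCombination hχ hkm hmin)
    have h2 := hχ.val_eq_of_chi_eq (hou'.chi_linearCombination hχ hkm hmin)
    rw [hχ.val_smul hfk, hu.val_eq hχ] at h1
    rw [hχ.val_smul hfk, hou'.val_eq hχ, ← heq, h1] at h2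
    exact (hu.strictMono hχ (lt_add_one _)).ne h2

end Move

/-! ### The rational vector space structure. -/

section RatModule

variable {Γ : Type*} [AddCommGroup Γ] [LinearOrder Γ] [IsOrderedAddMonoid Γ]

theorem nsmul_divBy {n : ℕ} {a : Γ} (h : ∃ b : Γ, n • b = a) : n • divBy n a = a := by
  rw [divBy, dif_pos h]
  exact h.choose_spec

theorem den_nsmul_ratMul (hd : ∀ n : ℕ, 0 < n → ∀ a : Γ, ∃ b : Γ, n • b = a) (q : ℚ) (a : Γ) :
    q.den • ratMul q a = q.num • a := by
  rw [ratMul, smul_comm, nsmul_divBy (hd _ q.pos a)]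

/-- Any fraction representing `q`, reduced or not, determines `ratMul q a`, by torsion-freeness. The
module axioms thus become integer identities. -/
theorem eq_ratMul (hd : ∀ n : ℕ, 0 < n → ∀ a : Γ, ∃ b : Γ, n • b = a) {q : ℚ} {a b : Γ} {n : ℕ}
    {m : ℤ} (hn : n ≠ 0) (hq : q = m / n) (h : n • b = m • a) : b = ratMul q a := by
  have hqd : (q.den : ℚ) ≠ 0 := by exact_mod_cast q.den_nz
  have hn' : (n : ℚ) ≠ 0 := by exact_mod_cast hn
  have e : (n : ℤ) * q.num = (q.den : ℤ) * m := by
    have h1 : (q.num : ℚ) / q.den = m / n := by rw [Rat.num_div_den, hq]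
    rw [div_eq_div_iff hqd hn'] at h1
    have : (n : ℚ) * q.num = q.den * m := by rw [mul_comm, h1, mul_comm]
    exact_mod_cast this
  refine nsmul_right_injective (M := Γ) (mul_ne_zero q.den_nz hn) ?_
  simp only
  rw [mul_smul, h, mul_comm, mul_smul, den_nsmul_ratMul hd, ← natCast_zsmul, ← natCast_zsmul,
    smul_smul, smul_smul, e]

/-- The `ℚ`-vector space structure of a divisible ordered abelian group. -/
@[reducible]
noncomputable def ratModule (hd : ∀ n : ℕ, 0 < n → ∀ a : Γ, ∃ b : Γ, n • b = a) : Module ℚ Γ where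
  smul := ratMul
  one_smul a := (eq_ratMul hd (n := 1) (m := 1) one_ne_zero (by simp) (by simp)).symm
  mul_smul p q a := by
    change ratMul _ _ = ratMul _ (ratMul _ _)
    refine (eq_ratMul hd (n := q.den * p.den) (m := q.num * p.num)
      (mul_ne_zero q.den_nz p.den_nz) ?_ ?_).symm
    · push_cast
      rw [mul_div_mul_comm, Rat.num_div_den, Rat.num_div_den, mul_comm]
    · rw [mul_smul, den_nsmul_ratMul hd, smul_comm, den_nsmul_ratMul hd, smul_smul, mul_comm]
  smul_zero q := by
    change ratMul _ _ = _
    exact (eq_ratMul hd (n := q.den) (m := q.num) q.den_nz (Rat.num_div_den q).symm (by simp)).symm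
  smul_add q a b := by
    change ratMul _ _ = ratMul _ _ + ratMul _ _
    refine (eq_ratMul hd (n := q.den) (m := q.num) q.den_nz (Rat.num_div_den q).symm ?_).symm
    rw [smul_add, den_nsmul_ratMul hd, den_nsmul_ratMul hd, smul_add]
  add_smul p q a := by
    change ratMul _ _ = ratMul _ _ + ratMul _ _
    refine (eq_ratMul hd (n := p.den * q.den) (m := p.num * q.den + p.den * q.num)
      (mul_ne_zero p.den_nz q.den_nz) ?_ ?_).symm
    · have hp : (p.den : ℚ) ≠ 0 := by exact_mod_cast p.den_nz
      have hq : (q.den : ℚ) ≠ 0 := by exact_mod_cast q.den_nz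
      push_cast
      rw [← div_add_div _ _ hp hq, Rat.num_div_den, Rat.num_div_den]
    · rw [smul_add, add_smul, mul_comm p.den, mul_smul, den_nsmul_ratMul hd, mul_comm q.den,
        mul_smul, den_nsmul_ratMul hd, mul_comm p.num, mul_smul, mul_smul, natCast_zsmul,
        natCast_zsmul]
  zero_smul a := by
    change ratMul _ _ = _
    exact (eq_ratMul hd (n := 1) (m := 0) one_ne_zero (by simp) (by simp)).symm

theorem divBy_eq_smul [Module ℚ Γ] {n : ℕ} (hn : n ≠ 0) (a : Γ) :
    divBy n a = (n : ℚ)⁻¹ • a := by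
  have h : n • ((n : ℚ)⁻¹ • a) = a := by
    rw [← Nat.cast_smul_eq_nsmul ℚ, smul_smul, mul_inv_cancel₀ (by exact_mod_cast hn), one_smul]
  exact nsmul_right_injective (M := Γ) hn ((nsmul_divBy ⟨_, h⟩).trans h.symm)

theorem ratMul_eq_smul [Module ℚ Γ] (q : ℚ) (a : Γ) : ratMul q a = q • a := by
  rw [ratMul, divBy_eq_smul q.den_nz, ← Int.cast_smul_eq_zsmul ℚ, smul_smul, ← div_eq_mul_inv,
    Rat.num_div_den]

theorem denselyOrdered_of_module [Module ℚ Γ] : DenselyOrdered Γ := by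
  refine ⟨fun a b hab => ?_⟩
  set t := (2⁻¹ : ℚ) • (b - a) with ht
  have h2 : t + t = b - a := by
    rw [ht, ← add_smul]
    norm_num
  have ht0 : 0 < t := by
    by_contra! hc
    exact (sub_pos.2 hab).not_ge (h2 ▸ add_nonpos hc hc)
  refine ⟨a + t, lt_add_of_pos_right a ht0, ?_⟩
  calc a + t < a + t + t := lt_add_of_pos_right _ ht0
    _ = b := by rw [add_assoc, h2]; abel

end RatModule

/-! ### The ultrapower and its countable saturation. -/

section Ultrapower

/-- Countable saturation of ultrapowers over `ℕ`. -/
theorem exists_eventually_hyperfilter {ι α : Type*} [Countable ι] [Nonempty α]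
    (P : ι → ℕ → α → Prop)
    (h : ∀ F : Finset ι, ∃ y : ℕ → α, ∀ k ∈ F, ∀ᶠ i in hyperfilter ℕ, P k i (y i)) :
    ∃ y : ℕ → α, ∀ k, ∀ᶠ i in hyperfilter ℕ, P k i (y i) := by
  classical
  rcases isEmpty_or_nonempty ι with hι | hι
  · exact ⟨fun _ => Classical.arbitrary α, fun k => isEmptyElim k⟩
  obtain ⟨e, he⟩ := exists_surjective_nat ι
  let S : ℕ → ℕ → Prop := fun i N => ∃ y, ∀ k < N, P (e k) i y
  have hS : ∀ i, S i (Nat.findGreatest (S i) i) := fun i =>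
    Nat.findGreatest_spec (P := S i) (m := 0) (Nat.zero_le i)
      ⟨Classical.arbitrary α, fun k hk => absurd hk (Nat.not_lt_zero k)⟩
  choose y hy using hS
  refine ⟨y, fun k => ?_⟩
  obtain ⟨k, rfl⟩ := he k
  obtain ⟨z, hz⟩ := h ((Finset.range (k + 1)).image e)
  have h1 : ∀ᶠ i in hyperfilter ℕ, ∀ j ∈ Finset.range (k + 1), P (e j) i (z i) :=
    (eventually_all_finset _).2 fun j hj => hz _ (Finset.mem_image_of_mem e hj)
  have h2 : ∀ᶠ i in hyperfilter ℕ, k + 1 ≤ i :=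
    (Nat.hyperfilter_le_atTop : (hyperfilter ℕ : Filter ℕ) ≤ atTop) (eventually_ge_atTop (k + 1))
  filter_upwards [h1, h2] with i hi1 hi2
  refine hy i k (Nat.lt_of_succ_le (Nat.le_findGreatest hi2 ⟨z i, fun j hj => ?_⟩))
  exact hi1 j (Finset.mem_range.2 hj)

/-- The ultrapower along the hyperfilter on `ℕ`. -/
noncomputable abbrev UPow (Γ : Type*) : Type _ := Germ (hyperfilter ℕ : Filter ℕ) Γ

variable {Γ : Type*} [AddCommGroup Γ] [LinearOrder Γ] [IsOrderedAddMonoid Γ]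

/-- The canonical extension of `χ` to the ultrapower. -/
noncomputable def uchi (χ : Γ → Γ) : UPow Γ → UPow Γ := Germ.map χ

theorem uchi_coe (χ : Γ → Γ) (f : ℕ → Γ) : uchi χ (f : UPow Γ) = ((fun i => χ (f i) : ℕ → Γ) :
    UPow Γ) := rfl

theorem coe_lt_zero_iff {f : ℕ → Γ} : (f : UPow Γ) < 0 ↔ ∀ᶠ i in hyperfilter ℕ, f i < 0 :=
  Germ.coe_lt (g := fun _ => (0 : Γ))

theorem coe_mem_negImage_iff {χ : Γ → Γ} {f : ℕ → Γ} :
    (f : UPow Γ) ∈ negImage (uchi χ) ↔ ∀ᶠ i in hyperfilter ℕ, f i ∈ negImage χ := by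
  constructor
  · rintro ⟨a, ha, e⟩
    induction a using Germ.inductionOn with | _ a =>
    have ha : (a : UPow Γ) < 0 := ha
    rw [coe_lt_zero_iff] at ha
    rw [uchi_coe, Germ.coe_eq] at e
    filter_upwards [ha, e] with i h1 h2
    exact ⟨a i, h1, h2⟩
  · intro h
    have : ∀ i, ∃ a : Γ, f i ∈ negImage χ → a < 0 ∧ χ a = f i := by
      intro i
      by_cases hi : f i ∈ negImage χ
      · obtain ⟨a, ha, e⟩ := hi
        exact ⟨a, fun _ => ⟨ha, e⟩⟩
      · exact ⟨0, fun h => absurd h hi⟩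
    choose a ha using this
    refine ⟨(a : UPow Γ), coe_lt_zero_iff.2 ?_, ?_⟩
    · filter_upwards [h] with i hi
      exact (ha i hi).1
    · rw [uchi_coe, Germ.coe_eq]
      filter_upwards [h] with i hi
      exact (ha i hi).2

theorem IsPdgGroup.uchi {χ : Γ → Γ} {c : Γ} (h : IsPdgGroup χ c) :
    IsPdgGroup (uchi χ) ((c : Γ) : UPow Γ) := by
  have hle : ∀ {f g : ℕ → Γ}, (f : UPow Γ) ≤ g ↔ ∀ᶠ i in hyperfilter ℕ, f i ≤ g i := Germ.coe_le
  have hlt : ∀ {f g : ℕ → Γ}, (f : UPow Γ) < g ↔ ∀ᶠ i in hyperfilter ℕ, f i < g i := Germ.coe_lt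
  have hc : ((c : Γ) : UPow Γ) = ((fun _ => c : ℕ → Γ) : UPow Γ) := rfl
  refine ⟨?_, ?_, ?_, ?_, ?_, ?_, ?_, ⟨?_, ?_⟩, ?_, ?_, ?_, ?_⟩
  · have := h.nontrivial
    infer_instance
  · exact congrArg (fun a : Γ => (a : UPow Γ)) h.zero
  · intro a b
    induction a using Germ.inductionOn with | _ a =>
    induction b using Germ.inductionOn with | _ b =>
    intro hab
    rw [hle] at hab
    rw [uchi_coe, uchi_coe, hle]
    exact hab.mono fun i hi => h.mono hi
  · intro a
    induction a using Germ.inductionOn with | _ a =>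
    exact congrArg (fun f : ℕ → Γ => (f : UPow Γ)) (funext fun i => h.neg (a i))
  · intro n hn a
    induction a using Germ.inductionOn with | _ a =>
    exact congrArg (fun f : ℕ → Γ => (f : UPow Γ)) (funext fun i => h.nsmul n hn (a i))
  · intro a ha
    induction a using Germ.inductionOn with | _ a =>
    rw [coe_lt_zero_iff] at ha
    rw [uchi_coe, hlt]
    exact ha.mono fun i hi => h.lt_chi _ hi
  · intro a ha
    induction a using Germ.inductionOn with | _ a =>
    rw [coe_lt_zero_iff] at ha
    rw [uchi_coe, coe_lt_zero_iff]
    exact ha.mono fun i hi => h.chi_neg _ hi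
  · rw [hc, coe_mem_negImage_iff]
    exact Eventually.of_forall fun _ => h.least.1
  · intro a ha
    induction a using Germ.inductionOn with | _ a =>
    rw [coe_mem_negImage_iff] at ha
    rw [hc, hle]
    exact ha.mono fun i hi => h.least.2 hi
  · intro a ha b hb e
    induction a using Germ.inductionOn with | _ a =>
    induction b using Germ.inductionOn with | _ b =>
    rw [coe_mem_negImage_iff] at ha hb
    rw [uchi_coe, uchi_coe, Germ.coe_eq] at e
    rw [Germ.coe_eq]
    filter_upwards [ha, hb, e] with i h1 h2 h3
    exact h.inj h1 h2 h3
  · intro x hx hcx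
    induction x using Germ.inductionOn with | _ x =>
    rw [coe_mem_negImage_iff] at hx
    rw [hc, hlt] at hcx
    have : ∀ i, ∃ a : Γ, x i ∈ negImage χ → c < x i → a ∈ negImage χ ∧ χ a = x i := by
      intro i
      by_cases hi : x i ∈ negImage χ ∧ c < x i
      · obtain ⟨a, ha, e⟩ := h.surj _ hi.1 hi.2
        exact ⟨a, fun _ _ => ⟨ha, e⟩⟩
      · exact ⟨0, fun h1 h2 => absurd ⟨h1, h2⟩ hi⟩
    choose a ha using this
    refine ⟨(a : UPow Γ), coe_mem_negImage_iff.2 ?_, ?_⟩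
    · filter_upwards [hx, hcx] with i h1 h2
      exact (ha i h1 h2).1
    · rw [uchi_coe, Germ.coe_eq]
      filter_upwards [hx, hcx] with i h1 h2
      exact (ha i h1 h2).2
  · intro x hx
    induction x using Germ.inductionOn with | _ x =>
    rw [coe_mem_negImage_iff] at hx
    rw [uchi_coe, hc, hlt]
    exact hx.mono fun i hi => h.lt_chi_image _ hi
  · intro a ha b hb hab
    induction a using Germ.inductionOn with | _ a =>
    induction b using Germ.inductionOn with | _ b =>
    rw [coe_mem_negImage_iff] at ha hb
    rw [hlt] at hab
    rw [uchi_coe, hle]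
    filter_upwards [ha, hb, hab] with i h1 h2 h3
    exact h.succ _ h1 _ h2 h3

/-- Finite satisfiability in the first clause comes from density and the absence of endpoints in a
nontrivial rational vector space; in the second it is the hypothesis. -/
theorem isSaturated_uchi [Module ℚ Γ] {χ : Γ → Γ} {c : Γ} (h : IsPdgGroup χ c) :
    IsSaturated (uchi χ) := by
  classical
  have hlt : ∀ {f g : ℕ → Γ}, (f : UPow Γ) < g ↔ ∀ᶠ i in hyperfilter ℕ, f i < g i := Germ.coe_lt
  have hrep : ∀ g : UPow Γ, ∃ f : ℕ → Γ, (f : UPow Γ) = g := fun g =>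
    Germ.inductionOn g fun f => ⟨f, rfl⟩
  choose rep hrep using hrep
  constructor
  · intro A B hA hB hAB
    have := hA.to_subtype
    have := hB.to_subtype
    have := h.uchi.nontrivial
    have : DenselyOrdered (UPow Γ) := denselyOrdered_of_module
    obtain ⟨y, hy⟩ := exists_eventually_hyperfilter (ι := A ⊕ B) (α := Γ)
      (fun k i y => Sum.elim (fun a : A => rep a i < y) (fun b : B => y < rep b i) k) (by
        intro F
        obtain ⟨m, hm1, hm2⟩ := Order.exists_between_finsets
          (F.toLeft.image ((↑) : A → UPow Γ)) (F.toRight.image ((↑) : B → UPow Γ)) (by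
            intro x hx y hy
            obtain ⟨a, -, rfl⟩ := Finset.mem_image.1 hx
            obtain ⟨b, -, rfl⟩ := Finset.mem_image.1 hy
            exact hAB a a.2 b b.2)
        refine ⟨rep m, ?_⟩
        rintro (a | b) hk
        · have := hm1 a (Finset.mem_image_of_mem _ (Finset.mem_toLeft.2 hk))
          rw [← hrep a, ← hrep m, hlt] at this
          exact this
        · have := hm2 b (Finset.mem_image_of_mem _ (Finset.mem_toRight.2 hk))
          rw [← hrep b, ← hrep m, hlt] at this
          exact this)
    refine ⟨(y : UPow Γ), fun a ha => ?_, fun b hb => ?_⟩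
    · rw [← hrep a, hlt]
      exact hy (Sum.inl ⟨a, ha⟩)
    · rw [← hrep b, hlt]
      exact hy (Sum.inr ⟨b, hb⟩)
  · intro C hC hfin
    have := hC.to_subtype
    have hiff : ∀ (f : ℕ → Γ) (z : UPow Γ × UPow Γ), uchi χ ((f : UPow Γ) - z.1) = z.2 ↔
        ∀ᶠ i in hyperfilter ℕ, χ (f i - rep z.1 i) = rep z.2 i := by
      intro f z
      conv_lhs => rw [← hrep z.1, ← hrep z.2]
      exact Germ.coe_eq
    obtain ⟨y, hy⟩ := exists_eventually_hyperfilter (ι := C) (α := Γ)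
      (fun z i y => χ (y - rep z.1.1 i) = rep z.1.2 i) (by
        intro F
        obtain ⟨y, hy⟩ := hfin (F.image (↑)) (by
          intro z hz
          obtain ⟨w, -, rfl⟩ := Finset.mem_image.1 (Finset.mem_coe.1 hz)
          exact w.2)
        refine ⟨rep y, fun z hz => (hiff _ _).1 ?_⟩
        rw [hrep]
        exact hy _ (Finset.mem_image_of_mem _ hz))
    exact ⟨(y : UPow Γ), fun z hz => (hiff _ _).2 (hy ⟨z, hz⟩)⟩

end Ultrapower

/-! ### Preservation of terms and formulas. -/

section Formula

variable {Γ : Type*} [AddCommGroup Γ] [LinearOrder Γ] [IsOrderedAddMonoid Γ]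

theorem chiInv_zero (χ : Γ → Γ) : chiInv χ 0 = 0 := by rw [chiInv, if_pos rfl]

theorem chiInv_chi {χ : Γ → Γ} {c : Γ} (h : IsPdgGroup χ c) {x : Γ} (hx : x ∈ negImage χ) :
    chiInv χ ((χ x : Γ) : WithTop Γ) = (x : WithTop Γ) := by
  have h0 : ((χ x : Γ) : WithTop Γ) ≠ 0 := fun e =>
    (h.chi_neg x (h.neg_of_mem hx)).ne (WithTop.coe_eq_coe.1 e)
  have h1 : ∃ a ∈ negImage χ, ((χ x : Γ) : WithTop Γ) = ((χ a : Γ) : WithTop Γ) := ⟨x, hx, rfl⟩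
  rw [chiInv, if_neg h0, dif_pos h1]
  exact congrArg _ (h.inj h1.choose_spec.1 hx (WithTop.coe_eq_coe.1 h1.choose_spec.2).symm)

theorem chiInv_neg_chi {χ : Γ → Γ} {c : Γ} (h : IsPdgGroup χ c) {x : Γ} (hx : x ∈ negImage χ) :
    chiInv χ ((-χ x : Γ) : WithTop Γ) = ((-x : Γ) : WithTop Γ) := by
  have hpos : 0 < -χ x := neg_pos.2 (h.chi_neg x (h.neg_of_mem hx))
  have h0 : ((-χ x : Γ) : WithTop Γ) ≠ 0 := fun e => hpos.ne' (WithTop.coe_eq_coe.1 e)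
  have h1 : ¬∃ a ∈ negImage χ, ((-χ x : Γ) : WithTop Γ) = ((χ a : Γ) : WithTop Γ) := by
    rintro ⟨a, ha, e⟩
    rw [WithTop.coe_eq_coe.1 e] at hpos
    exact hpos.not_gt (h.chi_neg a (h.neg_of_mem ha))
  have h2 : ∃ a ∈ negImage χ, ((-χ x : Γ) : WithTop Γ) = ((-χ a : Γ) : WithTop Γ) := ⟨x, hx, rfl⟩
  rw [chiInv, if_neg h0, dif_neg h1, dif_pos h2]
  refine congrArg (fun a : Γ => ((-a : Γ) : WithTop Γ)) (h.inj h2.choose_spec.1 hx ?_)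
  exact (neg_inj.1 (WithTop.coe_eq_coe.1 h2.choose_spec.2)).symm

theorem chiInv_eq_top {χ : Γ → Γ} {y : Γ} (h0 : y ≠ 0) (h1 : ¬∃ a ∈ negImage χ, χ a = y)
    (h2 : ¬∃ a ∈ negImage χ, χ a = -y) : chiInv χ (y : WithTop Γ) = ⊤ := by
  have h0' : (y : WithTop Γ) ≠ 0 := fun e => h0 (WithTop.coe_eq_coe.1 e)
  rw [chiInv, if_neg h0', dif_neg, dif_neg]
  · rintro ⟨a, ha, e⟩
    exact h2 ⟨a, ha, by rw [WithTop.coe_eq_coe.1 e, neg_neg]⟩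
  · rintro ⟨a, ha, e⟩
    exact h1 ⟨a, ha, (WithTop.coe_eq_coe.1 e).symm⟩

theorem chiInv_top (χ : Γ → Γ) : chiInv χ ⊤ = ⊤ := by
  rw [chiInv, if_neg (WithTop.top_ne_zero), dif_neg, dif_neg] <;>
  · rintro ⟨a, -, e⟩
    exact WithTop.top_ne_coe e

theorem exists_chi_eq_coe_iff {χ : Γ → Γ} {f : ℕ → Γ} :
    (∃ x ∈ negImage (uchi χ), uchi χ x = (f : UPow Γ)) ↔
      ∀ᶠ i in hyperfilter ℕ, ∃ a ∈ negImage χ, χ a = f i := by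
  constructor
  · rintro ⟨x, hx, e⟩
    induction x using Germ.inductionOn with | _ x =>
    rw [coe_mem_negImage_iff] at hx
    rw [uchi_coe, Germ.coe_eq] at e
    filter_upwards [hx, e] with i h1 h2
    exact ⟨_, h1, h2⟩
  · intro h
    have : ∀ i, ∃ x : Γ, (∃ a ∈ negImage χ, χ a = f i) → x ∈ negImage χ ∧ χ x = f i := by
      intro i
      by_cases hi : ∃ a ∈ negImage χ, χ a = f i
      · exact ⟨hi.choose, fun _ => hi.choose_spec⟩
      · exact ⟨0, fun h => absurd h hi⟩
    choose x hx using this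
    refine ⟨(x : UPow Γ), coe_mem_negImage_iff.2 (h.mono fun i hi => (hx i hi).1), ?_⟩
    rw [uchi_coe, Germ.coe_eq]
    exact h.mono fun i hi => (hx i hi).2

variable [Module ℚ Γ]

/-- Two sequences in `Γ_∞` which are corresponding points of the ultrapower. -/
def Related (R : Submodule ℚ (UPow Γ × UPow Γ)) (f f' : ℕ → WithTop Γ) : Prop :=
  (∀ᶠ i in hyperfilter ℕ, f i = ⊤ ∧ f' i = ⊤) ∨
    ∃ g g' : ℕ → Γ, (∀ᶠ i in hyperfilter ℕ, f i = g i ∧ f' i = g' i) ∧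
      ((g : UPow Γ), (g' : UPow Γ)) ∈ R

namespace Related

variable {R : Submodule ℚ (UPow Γ × UPow Γ)} {f f' h h' : ℕ → WithTop Γ}

theorem mono {R' : Submodule ℚ (UPow Γ × UPow Γ)} (hle : R ≤ R') (hf : Related R f f') :
    Related R' f f' := hf.imp id fun ⟨g, g', h1, h2⟩ => ⟨g, g', h1, hle h2⟩

theorem swap (hf : Related R f f') : Related (swapRel R) f' f :=
  hf.imp (fun h => h.mono fun _ hi => hi.symm)
    fun ⟨g, g', h1, h2⟩ => ⟨g', g, h1.mono fun _ hi => hi.symm, h2⟩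

theorem map {φ : Γ → Γ} (hφ : ∀ g g' : ℕ → Γ, ((g : UPow Γ), (g' : UPow Γ)) ∈ R →
    (((fun i => φ (g i) : ℕ → Γ) : UPow Γ), ((fun i => φ (g' i) : ℕ → Γ) : UPow Γ)) ∈ R)
    (hf : Related R f f') :
    Related R (fun i => WithTop.map φ (f i)) fun i => WithTop.map φ (f' i) := by
  rcases hf with hf | ⟨g, g', h1, h2⟩
  · left
    filter_upwards [hf] with i hi
    simp [hi.1, hi.2]
  · right
    refine ⟨_, _, ?_, hφ g g' h2⟩
    filter_upwards [h1] with i hi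
    simp [hi.1, hi.2]

theorem add (hf : Related R f f') (hh : Related R h h') :
    Related R (fun i => f i + h i) fun i => f' i + h' i := by
  rcases hf with hf | ⟨g, g', h1, h2⟩
  · left
    filter_upwards [hf] with i hi
    simp [hi.1, hi.2]
  rcases hh with hh | ⟨k, k', h3, h4⟩
  · left
    filter_upwards [hh] with i hi
    simp [hi.1, hi.2]
  · right
    refine ⟨g + k, g' + k', ?_, R.add_mem h2 h4⟩
    filter_upwards [h1, h3] with i hi hi'
    simp [hi.1, hi.2, hi'.1, hi'.2]

theorem coe {g g' : ℕ → Γ} (hg : ((g : UPow Γ), (g' : UPow Γ)) ∈ R) :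
    Related R (fun i => (g i : WithTop Γ)) fun i => (g' i : WithTop Γ) :=
  Or.inr ⟨g, g', Eventually.of_forall fun _ => ⟨rfl, rfl⟩, hg⟩

theorem congr (hf : Related R h h') (e : ∀ᶠ i in hyperfilter ℕ, f i = h i)
    (e' : ∀ᶠ i in hyperfilter ℕ, f' i = h' i) : Related R f f' := by
  rcases hf with hf | ⟨g, g', h1, h2⟩
  · left
    filter_upwards [hf, e, e'] with i hi h3 h4
    exact ⟨h3.trans hi.1, h4.trans hi.2⟩
  · right
    refine ⟨g, g', ?_, h2⟩
    filter_upwards [h1, e, e'] with i hi h3 h4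
    exact ⟨h3.trans hi.1, h4.trans hi.2⟩

theorem top : Related R (fun _ => ⊤) fun _ => ⊤ :=
  Or.inl (Eventually.of_forall fun _ => ⟨rfl, rfl⟩)

variable {χ : Γ → Γ} {c : Γ}

theorem exists_chi_eq (hχ : IsPdgGroup χ c) (hR : IsPartialIso (uchi χ) (c : UPow Γ) R)
    {y y' : UPow Γ} (hy : (y, y') ∈ R) {x : UPow Γ} (hx : x ∈ negImage (uchi χ))
    (e : uchi χ x = y) :
    ∃ x' ∈ negImage (uchi χ), uchi χ x' = y' ∧ (x, x') ∈ R := by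
  have hχ := hχ.uchi
  subst e
  have hX := hR.image_mem hχ hy (hχ.chi_mem_of_mem hx)
  obtain ⟨x', hx', e'⟩ := hχ.surj y' hX ((hR.lt_iff hR.c_mem hy).1 (hχ.lt_chi_image x hx))
  exact ⟨x', hx', e', hR.pred x hx x' hx' (by rwa [e'])⟩

theorem exists_chi_eq_iff (hχ : IsPdgGroup χ c) (hR : IsPartialIso (uchi χ) (c : UPow Γ) R)
    {y y' : UPow Γ} (hy : (y, y') ∈ R) :
    (∃ x ∈ negImage (uchi χ), uchi χ x = y) ↔ ∃ x ∈ negImage (uchi χ), uchi χ x = y' := by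
  constructor
  · rintro ⟨x, hx, e⟩
    obtain ⟨x', hx', e', -⟩ := exists_chi_eq hχ hR hy hx e
    exact ⟨x', hx', e'⟩
  · rintro ⟨x, hx, e⟩
    obtain ⟨x', hx', e', -⟩ := exists_chi_eq hχ hR.swap (mem_swapRel.2 hy) hx e
    exact ⟨x', hx', e'⟩

/-- Each case in the definition of `χ⁻¹` corresponds to a condition on germs that the partial
isomorphism respects, and the ultrafilter selects one case for almost all indices. -/
theorem chiInv (hχ : IsPdgGroup χ c) (hR : IsPartialIso (uchi χ) (c : UPow Γ) R)
    (hf : Related R f f') :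
    Related R (fun i => chiInv χ (f i)) fun i => Precontraction.chiInv χ (f' i) := by
  rcases hf with hf | ⟨g, g', h1, h2⟩
  · left
    filter_upwards [hf] with i hi
    simp [hi.1, hi.2, chiInv_top]
  suffices hs : Related R (fun i => Precontraction.chiInv χ (g i))
      fun i => Precontraction.chiInv χ (g' i) from
    hs.congr (h1.mono fun i hi => by rw [hi.1]) (h1.mono fun i hi => by rw [hi.2])
  have aux : ∀ {g g' : ℕ → Γ}, ((g : UPow Γ), (g' : UPow Γ)) ∈ R →
      (∃ x ∈ negImage (uchi χ), uchi χ x = (g : UPow Γ)) →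
      ∃ x x' : ℕ → Γ, (∀ᶠ i in hyperfilter ℕ, x i ∈ negImage χ ∧ χ (x i) = g i) ∧
        (∀ᶠ i in hyperfilter ℕ, x' i ∈ negImage χ ∧ χ (x' i) = g' i) ∧
        ((x : UPow Γ), (x' : UPow Γ)) ∈ R := by
    rintro g g' hg ⟨x, hx, e⟩
    obtain ⟨x', hx', e', hxx⟩ := exists_chi_eq hχ hR hg hx e
    induction x using Germ.inductionOn with | _ x =>
    induction x' using Germ.inductionOn with | _ x' =>
    rw [coe_mem_negImage_iff] at hx hx'
    rw [uchi_coe, Germ.coe_eq] at e e'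
    exact ⟨x, x', hx.and e, hx'.and e', hxx⟩
  by_cases c1 : (g : UPow Γ) = 0
  · have c1' : (g' : UPow Γ) = 0 := (hR.zero_iff h2).1 c1
    have e1 : ∀ᶠ i in hyperfilter ℕ, g i = 0 := Germ.coe_eq.1 c1
    have e2 : ∀ᶠ i in hyperfilter ℕ, g' i = 0 := Germ.coe_eq.1 c1'
    refine (coe (g := fun _ => 0) (g' := fun _ => 0) R.zero_mem).congr ?_ ?_
    · exact e1.mono fun i hi => by rw [hi]; exact chiInv_zero χ
    · exact e2.mono fun i hi => by rw [hi]; exact chiInv_zero χ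
  by_cases c2 : ∃ x ∈ negImage (uchi χ), uchi χ x = (g : UPow Γ)
  · obtain ⟨x, x', e, e', hxx⟩ := aux h2 c2
    refine (coe hxx).congr ?_ ?_
    · exact e.mono fun i hi => by rw [← hi.2, chiInv_chi hχ hi.1]
    · exact e'.mono fun i hi => by rw [← hi.2, chiInv_chi hχ hi.1]
  have h2n : (((-g : ℕ → Γ) : UPow Γ), ((-g' : ℕ → Γ) : UPow Γ)) ∈ R := R.neg_mem h2
  by_cases c3 : ∃ x ∈ negImage (uchi χ), uchi χ x = ((-g : ℕ → Γ) : UPow Γ)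
  · obtain ⟨x, x', e, e', hxx⟩ := aux h2n c3
    refine (coe (g := -x) (g' := -x') (R.neg_mem hxx)).congr ?_ ?_
    · refine e.mono fun i hi => ?_
      have e2 : g i = -χ (x i) := by rw [hi.2, Pi.neg_apply, neg_neg]
      rw [e2, chiInv_neg_chi hχ hi.1]
      rfl
    · refine e'.mono fun i hi => ?_
      have e2 : g' i = -χ (x' i) := by rw [hi.2, Pi.neg_apply, neg_neg]
      rw [e2, chiInv_neg_chi hχ hi.1]
      rfl
  have fin : ∀ {g : ℕ → Γ}, (g : UPow Γ) ≠ 0 →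
      (¬∃ x ∈ negImage (uchi χ), uchi χ x = (g : UPow Γ)) →
      (¬∃ x ∈ negImage (uchi χ), uchi χ x = ((-g : ℕ → Γ) : UPow Γ)) →
      ∀ᶠ i in hyperfilter ℕ, Precontraction.chiInv χ (g i) = ⊤ := by
    intro g c1 c2 c3
    rw [exists_chi_eq_coe_iff, ← Ultrafilter.eventually_not] at c2 c3
    have c1' : ∀ᶠ i in hyperfilter ℕ, ¬g i = 0 := by
      rw [Ultrafilter.eventually_not]
      exact fun h => c1 (Germ.coe_eq.2 h)
    filter_upwards [c1', c2, c3] with i d1 d2 d3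
    exact chiInv_eq_top d1 d2 d3
  refine top.congr (fin c1 c2 c3) (fin ?_ ?_ ?_)
  · exact fun h => c1 ((hR.zero_iff h2).2 h)
  · rwa [← exists_chi_eq_iff hχ hR h2]
  · rwa [← exists_chi_eq_iff hχ hR h2n]

theorem eventually_lt_iff (hR : IsPartialIso (uchi χ) (c : UPow Γ) R) (hf : Related R f f')
    (hh : Related R h h') :
    (∀ᶠ i in hyperfilter ℕ, f i < h i) ↔ ∀ᶠ i in hyperfilter ℕ, f' i < h' i := by
  rcases hf with hf | ⟨g, g', h1, h2⟩
  · refine iff_of_false ?_ ?_ <;> rw [← Ultrafilter.eventually_not] <;>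
    · filter_upwards [hf] with i hi
      simp [hi.1, hi.2]
  rcases hh with hh | ⟨k, k', h3, h4⟩
  · refine iff_of_true ?_ ?_ <;>
    · filter_upwards [h1, hh] with i hi hi'
      simp [hi.1, hi.2, hi'.1, hi'.2]
  have e := hR.lt_iff h2 h4
  rw [Germ.coe_lt, Germ.coe_lt] at e
  refine (eventually_congr ?_).trans (e.trans (eventually_congr ?_))
  · filter_upwards [h1, h3] with i hi hi'
    rw [hi.1, hi'.1, WithTop.coe_lt_coe]
  · filter_upwards [h1, h3] with i hi hi'
    rw [hi.2, hi'.2, WithTop.coe_lt_coe]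

theorem eventually_eq_iff (hR : IsPartialIso (uchi χ) (c : UPow Γ) R) (hf : Related R f f')
    (hh : Related R h h') :
    (∀ᶠ i in hyperfilter ℕ, f i = h i) ↔ ∀ᶠ i in hyperfilter ℕ, f' i = h' i := by
  have key : ∀ f h : ℕ → WithTop Γ, (∀ᶠ i in hyperfilter ℕ, f i = h i) ↔
      (¬∀ᶠ i in hyperfilter ℕ, f i < h i) ∧ ¬∀ᶠ i in hyperfilter ℕ, h i < f i := by
    intro f h
    rw [← Ultrafilter.eventually_not, ← Ultrafilter.eventually_not, ← eventually_and]
    refine eventually_congr (Eventually.of_forall fun i => ?_)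
    rw [not_lt, not_lt, and_comm]
    exact le_antisymm_iff
  rw [key, key, hf.eventually_lt_iff hR hh, hh.eventually_lt_iff hR hf]

end Related

theorem countable_swapRel {M : Type*} [AddCommGroup M] [Module ℚ M]
    {R : Submodule ℚ (M × M)} (hR : (R : Set (M × M)).Countable) :
    (swapRel R : Set (M × M)).Countable :=
  (hR.image Prod.swap).mono fun z hz =>
    show z ∈ Prod.swap '' (R : Set (M × M)) from ⟨z.swap, hz, rfl⟩

theorem IsPartialIso.exists_related {χ : Γ → Γ} {c : Γ} (hχ : IsPdgGroup χ c)
    {R : Submodule ℚ (UPow Γ × UPow Γ)} (hR : IsPartialIso (uchi χ) (c : UPow Γ) R)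
    (hRc : (R : Set (UPow Γ × UPow Γ)).Countable) (f' : ℕ → WithTop Γ) :
    ∃ R' : Submodule ℚ (UPow Γ × UPow Γ), R ≤ R' ∧ IsPartialIso (uchi χ) (c : UPow Γ) R' ∧
      (R' : Set (UPow Γ × UPow Γ)).Countable ∧ ∃ f, Related R' f f' := by
  by_cases hf : ∀ᶠ i in hyperfilter ℕ, f' i = ⊤
  · exact ⟨R, le_rfl, hR, hRc, fun _ => ⊤, Or.inl (hf.mono fun i hi => ⟨rfl, hi⟩)⟩
  rw [← Ultrafilter.eventually_not] at hf
  -- The default `0` occurs only where `f' i = ⊤`, a set outside the ultrafilter.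
  obtain ⟨R', hle, hR', hR'c, y, hy⟩ := hR.swap.exists_extend hχ.uchi (isSaturated_uchi hχ)
    (countable_swapRel hRc) ((fun i => (f' i).untopD 0 : ℕ → Γ) : UPow Γ)
  induction y using Germ.inductionOn with | _ y =>
  refine ⟨swapRel R', fun z hz => hle (mem_swapRel.2 hz), hR'.swap, countable_swapRel hR'c,
    fun i => (y i : WithTop Γ), Or.inr ⟨y, _, ?_, hy⟩⟩
  filter_upwards [hf] with i hi
  refine ⟨rfl, ?_⟩
  obtain ⟨a, ha⟩ := WithTop.ne_top_iff_exists.1 hi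
  rw [← ha]
  rfl

theorem related_realize_term {χ : Γ → Γ} {c : Γ} (hχ : IsPdgGroup χ c)
    {R : Submodule ℚ (UPow Γ × UPow Γ)} (hR : IsPartialIso (uchi χ) (c : UPow Γ) R)
    {α : Type*} (t : Lpdgs.Term α) {v v' : ℕ → α → WithTop Γ}
    (hv : ∀ a, Related R (fun i => v i a) fun i => v' i a) :
    letI : Lpdgs.Structure (WithTop Γ) := pdgStructure χ c
    Related R (fun i => t.realize (v i)) fun i => t.realize (v' i) := by
  let _ : Lpdgs.Structure (WithTop Γ) := pdgStructure χ c
  induction t with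
  | var a => exact hv a
  | @func l f ts ih =>
    cases f with
    | zero => exact Related.coe (g := fun _ => 0) (g' := fun _ => 0) R.zero_mem
    | c => exact Related.coe (g := fun _ => c) (g' := fun _ => c) hR.c_mem
    | infty => exact Related.top
    | neg => exact (ih 0).map fun g g' hg => R.neg_mem hg
    | chi => exact (ih 0).map fun g g' hg => hR.chi _ hg
    | chiInv => exact (ih 0).chiInv hχ hR
    | delta n =>
      refine (ih 0).map fun g g' hg => ?_
      simp only [divBy_eq_smul n.ne_zero]
      exact R.smul_mem _ hg
    | add => exact (ih 0).add (ih 1)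

/-- Formulas are preserved by partial isomorphisms of the ultrapower. -/
theorem eventually_realize_iff {χ : Γ → Γ} {c : Γ} (hχ : IsPdgGroup χ c)
    {α : Type*} {n : ℕ} (φ : Lpdgs.BoundedFormula α n) :
    letI : Lpdgs.Structure (WithTop Γ) := pdgStructure χ c
    ∀ (R : Submodule ℚ (UPow Γ × UPow Γ)), IsPartialIso (uchi χ) (c : UPow Γ) R →
      (R : Set (UPow Γ × UPow Γ)).Countable → ∀ (v v' : ℕ → α → WithTop Γ)
      (xs xs' : ℕ → Fin n → WithTop Γ), (∀ a, Related R (fun i => v i a) fun i => v' i a) →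
      (∀ j, Related R (fun i => xs i j) fun i => xs' i j) →
      ((∀ᶠ i in hyperfilter ℕ, φ.Realize (v i) (xs i)) ↔
        ∀ᶠ i in hyperfilter ℕ, φ.Realize (v' i) (xs' i)) := by
  let _ : Lpdgs.Structure (WithTop Γ) := pdgStructure χ c
  induction φ with
  | falsum => exact fun _ _ _ _ _ _ _ _ _ => Iff.rfl
  | equal t₁ t₂ =>
    intro R hR hRc v v' xs xs' hv hxs
    have hvx : ∀ a, Related R (fun i => Sum.elim (v i) (xs i) a)
        fun i => Sum.elim (v' i) (xs' i) a := by
      rintro (a | j)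
      · exact hv a
      · exact hxs j
    exact (related_realize_term hχ hR t₁ hvx).eventually_eq_iff hR
      (related_realize_term hχ hR t₂ hvx)
  | @rel n l r ts =>
    intro R hR hRc v v' xs xs' hv hxs
    have hvx : ∀ a, Related R (fun i => Sum.elim (v i) (xs i) a)
        fun i => Sum.elim (v' i) (xs' i) a := by
      rintro (a | j)
      · exact hv a
      · exact hxs j
    cases r with
    | lt =>
      exact (related_realize_term hχ hR (ts 0) hvx).eventually_lt_iff hR
        (related_realize_term hχ hR (ts 1) hvx)
  | imp φ ψ ih₁ ih₂ =>
    intro R hR hRc v v' xs xs' hv hxs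
    simp only [Language.BoundedFormula.realize_imp, Ultrafilter.eventually_imp]
    rw [ih₁ R hR hRc v v' xs xs' hv hxs, ih₂ R hR hRc v v' xs xs' hv hxs]
  | @all n φ ih =>
    -- One implication suffices, as `swapRel` gives the other. A counterexample chosen index by
    -- index is pulled back along an extension of `R`, which is why `R` varies in the induction.
    have aux : ∀ (R : Submodule ℚ (UPow Γ × UPow Γ)), IsPartialIso (uchi χ) (c : UPow Γ) R →
        (R : Set (UPow Γ × UPow Γ)).Countable → ∀ (v v' : ℕ → α → WithTop Γ)
        (xs xs' : ℕ → Fin n → WithTop Γ), (∀ a, Related R (fun i => v i a) fun i => v' i a) →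
        (∀ j, Related R (fun i => xs i j) fun i => xs' i j) →
        (∀ᶠ i in hyperfilter ℕ, φ.all.Realize (v i) (xs i)) →
          ∀ᶠ i in hyperfilter ℕ, φ.all.Realize (v' i) (xs' i) := by
      intro R hR hRc v v' xs xs' hv hxs hall
      by_contra hc
      rw [← Ultrafilter.eventually_not] at hc
      simp only [Language.BoundedFormula.realize_all, not_forall] at hc hall
      have : ∀ i, ∃ y, (∃ a, ¬φ.Realize (v' i) (Fin.snoc (xs' i) a)) →
          ¬φ.Realize (v' i) (Fin.snoc (xs' i) y) := by
        intro i
        by_cases hi : ∃ a, ¬φ.Realize (v' i) (Fin.snoc (xs' i) a)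
        · exact ⟨hi.choose, fun _ => hi.choose_spec⟩
        · exact ⟨0, fun h => absurd h hi⟩
      choose y' hy' using this
      obtain ⟨R', hle, hR', hR'c, y, hy⟩ := hR.exists_related hχ hRc y'
      have := (ih R' hR' hR'c v v' (fun i => Fin.snoc (xs i) (y i))
        (fun i => Fin.snoc (xs' i) (y' i)) (fun a => (hv a).mono hle) (by
          intro j
          induction j using Fin.lastCases with
          | last => simpa using hy
          | cast j => simpa using (hxs j).mono hle)).1 (hall.mono fun i hi => hi (y i))
      obtain ⟨i, h1, h2⟩ := (this.and hc).exists
      exact hy' i h2 h1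
    intro R hR hRc v v' xs xs' hv hxs
    refine ⟨aux R hR hRc v v' xs xs' hv hxs, aux (swapRel R) hR.swap
      (countable_swapRel hRc) v' v xs' xs
      (fun a => (hv a).swap) fun j => (hxs j).swap⟩

end Formula

/-! ### Definable functions and the finite subdivision. -/

section Definable

variable {Γ : Type*} [AddCommGroup Γ] [LinearOrder Γ] [IsOrderedAddMonoid Γ] [Module ℚ Γ]

/-- The sequence of pairs `(f i, g i)` is eventually in the graph of `G`. -/
def GraphAt {χ : Γ → Γ} (G : negImage χ → Γ) (f g : ℕ → Γ) : Prop :=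
  ∀ᶠ i in hyperfilter ℕ, ∃ t : negImage χ, (t : Γ) = f i ∧ G t = g i

theorem GraphAt.unique {χ : Γ → Γ} {G : negImage χ → Γ} {f g g' : ℕ → Γ} (h : GraphAt G f g)
    (h' : GraphAt G f g') : (g : UPow Γ) = g' := by
  rw [Germ.coe_eq]
  filter_upwards [h, h'] with i ⟨t, h1, h2⟩ ⟨t', h1', h2'⟩
  rw [← h2, ← h2', Subtype.ext (h1.trans h1'.symm)]

/-- The graph of `G` in the ultrapower is preserved by countable partial isomorphisms which are the
identity on `P`. -/
def IsInvariantOver {χ : Γ → Γ} (c : Γ) (G : negImage χ → Γ) (P : Submodule ℚ Γ) : Prop :=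
  ∀ R : Submodule ℚ (UPow Γ × UPow Γ), IsPartialIso (uchi χ) (c : UPow Γ) R →
    (R : Set (UPow Γ × UPow Γ)).Countable → (∀ p ∈ P, ((p : UPow Γ), (p : UPow Γ)) ∈ R) →
    ∀ f f' g g' : ℕ → Γ, ((f : UPow Γ), (f' : UPow Γ)) ∈ R → ((g : UPow Γ), (g' : UPow Γ)) ∈ R →
    GraphAt G f g → GraphAt G f' g'

theorem IsDefinableFun.exists_isInvariantOver {χ : Γ → Γ} {c : Γ} (hχ : IsPdgGroup χ c)
    {G : negImage χ → Γ} (hG : IsDefinableFun χ c G) :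
    ∃ P : Submodule ℚ Γ, IsSubstructure χ c P ∧ (P : Set Γ).Countable ∧
      IsInvariantOver c G P := by
  classical
  let _ : Lpdgs.Structure (WithTop Γ) := pdgStructure χ c
  obtain ⟨φ, hφ⟩ := Set.definable_iff_exists_formula_sum.1 hG
  let S : Set Γ := {a | Sum.inl ⟨(a : WithTop Γ), mem_univ _⟩ ∈ φ.freeVarFinset}
  have hS : S.Countable := by
    refine MapsTo.countable_of_injOn
      (f := fun a : Γ => (Sum.inl ⟨(a : WithTop Γ), mem_univ _⟩ : (univ : Set (WithTop Γ)) ⊕ Fin 2))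
      (t := (φ.freeVarFinset : Set _)) (fun a ha => ha) ?_ (Finset.countable_toSet _)
    intro a _ b _ e
    simpa using e
  obtain ⟨P, hP, hPc, hSP⟩ := exists_countable_substructure hχ hS
  refine ⟨P, hP, hPc, fun R hR hRc hPR f f' g g' hf hg hGr => ?_⟩
  let v : (ℕ → Γ) → (ℕ → Γ) → ℕ → (univ : Set (WithTop Γ)) ⊕ Fin 2 → WithTop Γ := fun f g i =>
    Sum.elim Subtype.val ![(f i : WithTop Γ), (g i : WithTop Γ)]
  have hv : ∀ (f g : ℕ → Γ) i, φ.Realize (v f g i) ↔ ∃ t : negImage χ, (t : Γ) = f i ∧ G t = g i := by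
    intro f g i
    have := Set.ext_iff.1 hφ ![(f i : WithTop Γ), (g i : WithTop Γ)]
    simp only [mem_ofPred_eq] at this
    rw [← this]
    simp only [Matrix.cons_val_zero, Matrix.cons_val_one, Prod.mk.injEq, WithTop.coe_eq_coe]
    exact exists_congr fun t => and_congr eq_comm eq_comm
  -- Every element of `Γ_∞` is a formal parameter of `φ`. Only those that occur lie in `P` or equal
  -- `⊤`, and only these are known to be related to themselves.
  let ψ : Lpdgs.Formula φ.freeVarFinset := φ.restrictFreeVar id
  have hψ : ∀ (f g : ℕ → Γ) i, Language.BoundedFormula.Realize ψ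
      (fun a : φ.freeVarFinset => v f g i a) (default : Fin 0 → WithTop Γ) ↔
      ∃ t : negImage χ, (t : Γ) = f i ∧ G t = g i := by
    intro f g i
    rw [← hv]
    have := Language.BoundedFormula.realize_restrictFreeVar (φ := φ) (f := id)
      (v := fun a : φ.freeVarFinset => v f g i a) (xs := (default : Fin 0 → WithTop Γ)) (v f g i)
      fun _ => rfl
    rw [Language.Formula.Realize]
    convert this
  have := (eventually_realize_iff hχ ψ R hR hRc (fun i a => v f g i a) (fun i a => v f' g' i a)
    (fun _ => default) (fun _ => default) ?_ (fun j => j.elim0)).1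
  · simp only [hψ] at this
    exact this hGr
  · rintro ⟨⟨a, -⟩ | j, ha⟩
    · induction a using WithTop.recTopCoe with
      | top => exact Related.top
      | coe a => exact Related.coe (g := fun _ => a) (g' := fun _ => a) (hPR a (hSP ha))
    · fin_cases j
      · exact Related.coe hf
      · exact Related.coe hg

/-- The diagonal embedding into the ultrapower. -/
noncomputable def constLinearMap (Γ : Type*) [AddCommGroup Γ] [Module ℚ Γ] : Γ →ₗ[ℚ] UPow Γ where
  toFun a := (a : UPow Γ)
  map_add' _ _ := rfl
  map_smul' _ _ := rfl

theorem mem_map_const {P : Submodule ℚ Γ} {z : UPow Γ} :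
    z ∈ P.map (constLinearMap Γ) ↔ ∃ p ∈ P, (p : UPow Γ) = z := Iff.rfl

theorem const_mem_negImage_iff {χ : Γ → Γ} {p : Γ} :
    (p : UPow Γ) ∈ negImage (uchi χ) ↔ p ∈ negImage χ :=
  (coe_mem_negImage_iff (f := fun _ => p)).trans eventually_const

theorem IsSubstructure.map_const {χ : Γ → Γ} {c : Γ} (hχ : IsPdgGroup χ c)
    {P : Submodule ℚ Γ} (hP : IsSubstructure χ c P) :
    IsSubstructure (uchi χ) (c : UPow Γ) (P.map (constLinearMap Γ)) := by
  refine ⟨?_, ⟨c, hP.c_mem, rfl⟩, ?_⟩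
  · rintro _ ⟨p, hp, rfl⟩
    exact ⟨χ p, hP.chi p hp, rfl⟩
  · intro x hx h
    obtain ⟨p, hp, e⟩ := mem_map_const.1 h
    have := (exists_chi_eq_coe_iff (f := fun _ => p)).1 ⟨x, hx, e.symm⟩
    rw [eventually_const] at this
    obtain ⟨a, ha, rfl⟩ := this
    refine mem_map_const.2 ⟨a, hP.pred a ha hp, ?_⟩
    exact hχ.uchi.inj (const_mem_negImage_iff.2 ha) hx e

/-- If the value of `G` were outside `A`, a partial isomorphism fixing `A`, and with it the
argument, would move it, giving two values at one point. -/
theorem IsInvariantOver.mem {χ : Γ → Γ} {c : Γ} (hχ : IsPdgGroup χ c) {G : negImage χ → Γ}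
    {P : Submodule ℚ Γ} (hP : IsInvariantOver c G P) {A : Submodule ℚ (UPow Γ)}
    (hA : IsSubstructure (uchi χ) (c : UPow Γ) A) (hAc : (A : Set (UPow Γ)).Countable)
    (hPA : P.map (constLinearMap Γ) ≤ A) {f g : ℕ → Γ} (hf : (f : UPow Γ) ∈ A)
    (hG : GraphAt G f g) : (g : UPow Γ) ∈ A := by
  by_contra hg
  obtain ⟨R, hle, hR, hRc, y, hne, hy⟩ := hA.exists_move hχ.uchi (isSaturated_uchi hχ) hAc hg
  induction y using Germ.inductionOn with | _ g' =>
  have hd : ∀ a ∈ A, (a, a) ∈ R := fun a ha => hle (mem_diag.2 ⟨ha, rfl⟩)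
  exact hne ((hP R hR hRc (fun p hp => hd _ (hPA ⟨p, hp, rfl⟩)) f f g g' (hd _ hf) hy hG).unique hG)

/-- The function `x ↦ ∑ f k • χ^k x + b`. -/
noncomputable def chiFun (χ : Γ → Γ) (b : Γ) (f : ℤ →₀ ℚ) (x : negImage χ) : WithTop Γ :=
  (∑ k ∈ f.support, WithTop.map (ratMul (f k)) (chiPow χ k ((x : Γ) : WithTop Γ))) +
    (b : WithTop Γ)

theorem isChiFunction_chiFun (χ : Γ → Γ) (b : Γ) (f : ℤ →₀ ℚ) :
    IsChiFunction χ (chiFun χ b f) := by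
  by_cases hf : f = 0
  · left
    exact ⟨b, fun x => by simp [chiFun, hf]⟩
  right
  refine ⟨f.support.card, Finset.card_pos.2 (Finsupp.support_nonempty_iff.2 hf),
    f.support.orderEmbOfFin rfl, (f.support.orderEmbOfFin rfl).strictMono,
    fun i => f (f.support.orderEmbOfFin rfl i),
    fun i => Finsupp.mem_support_iff.1 (Finset.orderEmbOfFin_mem _ rfl i), -b, fun x => ?_⟩
  rw [neg_neg, chiFun, ← Finset.sum_coe_sort]
  congr 1
  exact ((f.support.orderIsoOfFin rfl).toEquiv.sum_comp fun k : f.support =>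
    WithTop.map (ratMul (f k)) (chiPow χ k ((x : Γ) : WithTop Γ))).symm

/-- An orbit in the ultrapower has all its predecessors, so even the negative powers are finite at
almost all indices. -/
theorem IsOrbit.eventually_chiPow {χ : Γ → Γ} {c : Γ} (hχ : IsPdgGroup χ c) {u : ℤ → UPow Γ}
    (hu : IsOrbit (uchi χ) u) {x : ℕ → Γ} (hx : u 0 = x) (k : ℤ) :
    ∃ w : ℕ → Γ, u k = w ∧ ∀ᶠ i in hyperfilter ℕ, chiPow χ k (x i : WithTop Γ) = w i := by
  rcases k with n | n
  · induction n with
    | zero => exact ⟨x, hx, Eventually.of_forall fun _ => rfl⟩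
    | succ n ih =>
      obtain ⟨w, h1, h2⟩ := ih
      refine ⟨fun i => χ (w i), ?_, h2.mono fun i hi => ?_⟩
      · have := (hu (n : ℤ)).2
        rw [show u (n : ℤ) = w from h1] at this
        exact this
      · change (chiTop χ)^[n + 1] _ = _
        rw [Function.iterate_succ_apply']
        exact congrArg (chiTop χ) hi
  · have key : ∀ n : ℕ, ∃ w : ℕ → Γ, u (-(n : ℤ)) = w ∧
        ∀ᶠ i in hyperfilter ℕ, (chiInv χ)^[n] (x i : WithTop Γ) = w i := by
      intro n
      induction n with
      | zero => exact ⟨x, by simpa using hx, Eventually.of_forall fun _ => rfl⟩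
      | succ n ih =>
        obtain ⟨w, h1, h2⟩ := ih
        obtain ⟨hX, e⟩ := hu (-((n + 1 : ℕ) : ℤ))
        have e0 : (-((n + 1 : ℕ) : ℤ)) + 1 = -(n : ℤ) := by push_cast; ring
        rw [e0, h1] at e
        generalize u (-((n + 1 : ℕ) : ℤ)) = y at hX e
        induction y using Germ.inductionOn with | _ y =>
        rw [coe_mem_negImage_iff] at hX
        rw [uchi_coe, Germ.coe_eq] at e
        refine ⟨y, rfl, ?_⟩
        filter_upwards [hX, e, h2] with i d1 d2 d3
        rw [Function.iterate_succ_apply', d3, d2, chiInv_chi hχ d1]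
    obtain ⟨w, h1, h2⟩ := key (n + 1)
    exact ⟨w, h1, h2⟩

theorem IsOrbit.eventually_chiFun {χ : Γ → Γ} {c : Γ} (hχ : IsPdgGroup χ c) {u : ℤ → UPow Γ}
    (hu : IsOrbit (uchi χ) u) {x : ℕ → negImage χ}
    (hx : u 0 = ((fun i => (x i : Γ) : ℕ → Γ) : UPow Γ)) (b : Γ) (f : ℤ →₀ ℚ) :
    ∃ w : ℕ → Γ, (b : UPow Γ) + Finsupp.linearCombination ℚ u f = w ∧
      ∀ᶠ i in hyperfilter ℕ, chiFun χ b f (x i) = w i := by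
  choose w h1 h2 using hu.eventually_chiPow hχ hx
  refine ⟨(fun _ => b) + ∑ k ∈ f.support, f k • w k, ?_, ?_⟩
  · have e : (((∑ k ∈ f.support, f k • w k : ℕ → Γ)) : UPow Γ) =
        ∑ k ∈ f.support, f k • ((w k : ℕ → Γ) : UPow Γ) :=
      map_sum (Germ.coeAddHom (M := Γ) (hyperfilter ℕ : Filter ℕ)) _ _
    rw [Germ.coe_add, e, Finsupp.linearCombination_apply, Finsupp.sum]
    simp only [h1]
    rfl
  · have := (eventually_all_finset (l := (hyperfilter ℕ : Filter ℕ)) f.support).2 fun k _ => h2 k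
    filter_upwards [this] with i hi
    rw [chiFun, Finset.sum_congr rfl fun k hk => by
      rw [hi k hk, WithTop.map_coe, ratMul_eq_smul], ← WithTop.coe_sum, ← WithTop.coe_add, add_comm]
    simp

/-- There is a finite set `T` such that `G` agrees with a `χ`-function on each interval `[a, b)`
without points of `T` in its interior. -/
theorem IsInvariantOver.exists_agree {χ : Γ → Γ} {c : Γ} (hχ : IsPdgGroup χ c)
    {G : negImage χ → Γ} {P : Submodule ℚ Γ} (hP : IsInvariantOver c G P)
    (hPs : IsSubstructure χ c P) (hPc : (P : Set Γ).Countable) :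
    ∃ T : Finset Γ, (∀ p ∈ T, p ∈ negImage χ) ∧ ∀ a ∈ negImage χ, ∀ b : Γ, a < b →
      (∀ p ∈ T, a < p → b ≤ p) → ∃ (d : Γ) (f : ℤ →₀ ℚ), ∀ x : negImage χ, a ≤ x → (x : Γ) < b →
        ((G x : Γ) : WithTop Γ) = chiFun χ d f x := by
  classical
  obtain ⟨p, hp⟩ := (hPc.mono (inter_subset_right (s := negImage χ))).exists_eq_range
    ⟨c, hχ.least.1, hPs.c_mem⟩
  have hpX : ∀ n, p n ∈ negImage χ ∩ P := fun n => hp ▸ mem_range_self n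
  have : Countable P := hPc.to_subtype
  -- This enumerates all candidate `χ`-functions with constant term in `P`.
  obtain ⟨e, he⟩ := exists_surjective_nat (P × (ℤ →₀ ℚ))
  by_contra! hcon
  -- The `N`-th bad interval has none of the first `N` points of `P ∩ X` in its interior, and on it
  -- every candidate `j` fails at some point.
  have hN : ∀ N : ℕ, ∃ a : negImage χ, ∃ b : Γ, (a : Γ) < b ∧
      (∀ i < N, (a : Γ) < p i → b ≤ p i) ∧ ∀ j, ∃ x : negImage χ, (a : Γ) ≤ x ∧ (x : Γ) < b ∧
        ((G x : Γ) : WithTop Γ) ≠ chiFun χ (e j).1 (e j).2 x := by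
    intro N
    obtain ⟨a, ha, b, hab, h1, h2⟩ := hcon ((Finset.range N).image p) (fun q hq => by
      obtain ⟨i, -, rfl⟩ := Finset.mem_image.1 hq
      exact (hpX i).1)
    exact ⟨⟨a, ha⟩, b, hab,
      fun i hi => h1 _ (Finset.mem_image_of_mem p (Finset.mem_range.2 hi)),
      fun j => h2 (e j).1 (e j).2⟩
  choose a b hab hno x hax hxb hne using hN
  have hχ' := hχ.uchi
  set A := P.map (constLinearMap Γ) with hA
  have hAs : IsSubstructure (uchi χ) (c : UPow Γ) A := hPs.map_const hχ
  have hAc : (A : Set (UPow Γ)).Countable := hPc.image _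
  set a' : UPow Γ := ((fun i => (a i : Γ) : ℕ → Γ) : UPow Γ) with ha'
  set b' : UPow Γ := (b : UPow Γ) with hb'
  have haX : a' ∈ negImage (uchi χ) :=
    coe_mem_negImage_iff.2 (Eventually.of_forall fun i => (a i).2)
  have hgap : ∀ z ∈ A, z ∈ negImage (uchi χ) → a' < z → b' ≤ z := by
    rintro _ ⟨q, hq, rfl⟩ hz haz
    obtain ⟨i, rfl⟩ : q ∈ range p := hp ▸ ⟨const_mem_negImage_iff.1 hz, hq⟩
    have h1 : ∀ᶠ N in hyperfilter ℕ, (a N : Γ) < p i := Germ.coe_lt.1 haz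
    have h2 : ∀ᶠ N in hyperfilter ℕ, i + 1 ≤ N :=
      (Nat.hyperfilter_le_atTop : (hyperfilter ℕ : Filter ℕ) ≤ atTop) (eventually_ge_atTop (i + 1))
    refine Germ.coe_le.2 ?_
    filter_upwards [h1, h2] with N d1 d2
    exact hno N i d2 d1
  have hGa : GraphAt G (fun i => (a i : Γ)) fun i => G (a i) :=
    Eventually.of_forall fun i => ⟨a i, rfl, rfl⟩
  by_cases haA : a' ∈ A
  -- If `a'` is in `A`, so is its successor, and the interval contains no point of `X` but `a'`; a
  -- constant then agrees with `G`.
  · have hle : b' ≤ uchi χ a' :=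
      hgap _ (hAs.chi _ haA) (hχ'.chi_mem_of_mem haX) (hχ'.lt_chi_of_mem haX)
    have hle' : ∀ᶠ i in hyperfilter ℕ, b i ≤ χ (a i) := Germ.coe_le.1 hle
    obtain ⟨d, hd, ed⟩ := mem_map_const.1 (hP.mem hχ hAs hAc le_rfl haA hGa)
    have ed : ∀ᶠ i in hyperfilter ℕ, d = G (a i) := Germ.coe_eq.1 ed
    obtain ⟨j, hj⟩ := he (⟨d, hd⟩, 0)
    obtain ⟨i, h1, h2⟩ := (hle'.and ed).exists
    have hxa : x i j = a i := by
      refine Subtype.ext (le_antisymm ?_ (hax i j))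
      by_contra! hlt
      exact ((hxb i j).trans_le h1).not_ge (hχ.succ _ (a i).2 _ (x i j).2 hlt)
    refine hne i j ?_
    rw [hj, hxa, ← h2]
    simp [chiFun]
  · obtain ⟨u, hu, hu0⟩ := hAs.exists_orbit hχ' haX haA
    have hAd := hAs.isPartialIso_diag hχ'
    have h0 : u 0 ∉ relDom (diag A) := by rwa [relDom_diag, hu0]
    -- The identity on `A` plus the span of the orbit shows, through its domain, that this span is a
    -- substructure. It contains `a'`, hence also the value of `G` there.
    have hR₁ : IsPartialIso (uchi χ) (c : UPow Γ) (adjoinOrbit (diag A) u u) := by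
      refine hAd.adjoin_orbit hχ' hu hu h0 fun z hz _ => ?_
      rw [(mem_diag.1 hz).2]
      exact ⟨id, id⟩
    have hmem := hP.mem hχ (hR₁.isSubstructure_relDom hχ')
      (((countable_adjoinOrbit (countable_diag hAc) u u).image Prod.fst).mono fun y hy => by
        obtain ⟨y', hy⟩ := mem_relDom.1 hy
        exact ⟨_, hy, rfl⟩)
      (fun z hz => mem_relDom.2 ⟨z, le_adjoinOrbit _ _ _ (mem_diag.2 ⟨hz, rfl⟩)⟩)
      (f := fun i => (a i : Γ))
      (mem_relDom.2 ⟨_, by rw [← ha', ← hu0]; exact orbit_mem_adjoinOrbit _ _ _ 0⟩) hGa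
    obtain ⟨y', hy'⟩ := mem_relDom.1 hmem
    obtain ⟨w, hw, f, ew⟩ := mem_adjoinOrbit.1 hy'
    have ew : ((fun i => G (a i) : ℕ → Γ) : UPow Γ) = _ := (Prod.ext_iff.1 ew).1
    simp only at ew
    obtain ⟨hw1, hw2⟩ := mem_diag.1 hw
    obtain ⟨d, hd, ed⟩ := mem_map_const.1 hw1
    obtain ⟨j, hj⟩ := he (⟨d, hd⟩, f)
    set x' : UPow Γ := ((fun i => (x i j : Γ) : ℕ → Γ) : UPow Γ) with hx'
    have hxX : x' ∈ negImage (uchi χ) :=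
      coe_mem_negImage_iff.2 (Eventually.of_forall fun i => (x i j).2)
    have hax' : a' ≤ x' := Germ.coe_le.2 (Eventually.of_forall fun i => hax i j)
    have hxb' : x' < b' := Germ.coe_lt.2 (Eventually.of_forall fun i => hxb i j)
    have hxA : x' ∉ A := fun h => by
      rcases hax'.eq_or_lt with h1 | h1
      · exact haA (h1 ▸ h)
      · exact hxb'.not_ge (hgap _ h hxX h1)
    obtain ⟨u', hu', hu0'⟩ := hAs.exists_orbit hχ' hxX hxA
    -- The failure point `x'` of candidate `j` has the same cut over `A` as `a'`. The isomorphism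
    -- taking `a'` to `x'` forces `G` to agree with the candidate at `x'`, a contradiction.
    have hR := hAd.adjoin_orbit hχ' hu hu' h0 (fun z hz hzX => by
      obtain ⟨d1, d2⟩ := mem_diag.1 hz
      rw [← d2, hu0, hu0']
      exact ⟨fun h => h.trans_le hax', fun h => hxb'.trans_le (hgap _ d1 hzX h)⟩)
    obtain ⟨v, hv1, hv2⟩ := hu'.eventually_chiFun hχ hu0' d f
    have hGx := hP _ hR (countable_adjoinOrbit (countable_diag hAc) u u')
      (fun q hq => le_adjoinOrbit _ _ _ (mem_diag.2 ⟨⟨q, hq, rfl⟩, rfl⟩)) (fun i => (a i : Γ))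
      (fun i => (x i j : Γ)) (fun i => G (a i)) v (by
        rw [← ha', ← hx', ← hu0, ← hu0']
        exact orbit_mem_adjoinOrbit _ _ _ 0) (by
        rw [ew, ← hv1, ← ed]
        exact mem_adjoinOrbit.2 ⟨(_, _), mem_diag.2 ⟨⟨d, hd, rfl⟩, rfl⟩, f, rfl⟩) hGa
    obtain ⟨i, ⟨t, h1, h2⟩, h3⟩ := (hGx.and hv2).exists
    refine hne i j ?_
    have ht : t = x i j := Subtype.ext h1
    rw [hj, h3, ← h2, ht]

theorem isPiecewiseChi_of_agree {χ : Γ → Γ} {c : Γ} (hχ : IsPdgGroup χ c) {G : negImage χ → Γ}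
    {T : Finset Γ} (hT : ∀ p ∈ T, p ∈ negImage χ)
    (hagree : ∀ a ∈ negImage χ, ∀ b : Γ, a < b → (∀ p ∈ T, a < p → b ≤ p) →
      ∃ (d : Γ) (f : ℤ →₀ ℚ), ∀ x : negImage χ, a ≤ x → (x : Γ) < b →
        ((G x : Γ) : WithTop Γ) = chiFun χ d f x) : IsPiecewiseChi χ c G := by
  classical
  -- The breakpoints are the elements of `S` in increasing order; no point of `T` is strictly
  -- between two consecutive ones.
  set S : Finset Γ := insert 0 (insert c T) with hS
  have hSX : ∀ s ∈ S, s ∈ negImage χ ∪ {0} := by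
    intro s hs
    rcases Finset.mem_insert.1 hs with rfl | hs
    · exact Or.inr rfl
    rcases Finset.mem_insert.1 hs with rfl | hs
    · exact Or.inl hχ.least.1
    · exact Or.inl (hT s hs)
  have hS0 : ∀ s ∈ S, s ≤ 0 := fun s hs => by
    rcases hSX s hs with h | h
    · exact (hχ.neg_of_mem h).le
    · exact le_of_eq h
  have hSc : ∀ s ∈ S, c ≤ s := fun s hs => by
    rcases hSX s hs with h | h
    · exact hχ.least.2 h
    · rw [show s = 0 from h]
      exact (hχ.neg_of_mem hχ.least.1).le
  have h0S : (0 : Γ) ∈ S := Finset.mem_insert_self _ _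
  have hcS : c ∈ S := Finset.mem_insert_of_mem (Finset.mem_insert_self _ _)
  obtain ⟨m, hm⟩ : ∃ m, S.card = m + 1 :=
    Nat.exists_eq_succ_of_ne_zero (Finset.card_pos.2 ⟨0, h0S⟩).ne'
  set a := S.orderEmbOfFin hm with ha
  have haS : ∀ i, a i ∈ S := Finset.orderEmbOfFin_mem S hm
  have hsurj : ∀ s ∈ S, ∃ i, a i = s := fun s hs => by
    have : s ∈ Set.range a := by rwa [ha, Finset.range_orderEmbOfFin]
    exact this
  refine ⟨m, a, fun i => hSX _ (haS i), a.strictMono, ?_, ?_, fun i => ?_⟩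
  · obtain ⟨i, hi⟩ := hsurj c hcS
    exact le_antisymm (hi ▸ a.monotone (Fin.zero_le i)) (hSc _ (haS _))
  · obtain ⟨i, hi⟩ := hsurj 0 h0S
    exact le_antisymm (hS0 _ (haS _)) (hi ▸ a.monotone (Fin.le_last i))
  · have hlt : a i.castSucc < a i.succ := a.strictMono Fin.castSucc_lt_succ
    have hX : a i.castSucc ∈ negImage χ := (hSX _ (haS _)).resolve_right fun h =>
      (hlt.trans_le (hS0 _ (haS _))).ne h
    obtain ⟨d, f, hdf⟩ := hagree _ hX _ hlt (by
      intro p hp hap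
      obtain ⟨j, rfl⟩ := hsurj p (Finset.mem_insert_of_mem (Finset.mem_insert_of_mem hp))
      exact a.monotone (Fin.castSucc_lt_iff_succ_le.1 (a.lt_iff_lt.1 hap)))
    exact ⟨_, isChiFunction_chiFun χ d f, hdf⟩

end Definable

end Precontraction

theorem mainTheorem5 {Γ : Type*} [AddCommGroup Γ] [LinearOrder Γ] [IsOrderedAddMonoid Γ]
    (χ : Γ → Γ) (c : Γ) (hΓ : Precontraction.IsTpdgModel χ c)
    (G : Precontraction.negImage χ → Γ) (hG : Precontraction.IsDefinableFun χ c G) :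
    Precontraction.IsPiecewiseChi χ c G := by
  let _ : Module ℚ Γ := Precontraction.ratModule hΓ.divisible
  have hχ := hΓ.isPdgGroup
  obtain ⟨P, hPs, hPc, hP⟩ := hG.exists_isInvariantOver hχ
  obtain ⟨T, hT, hagree⟩ := hP.exists_agree hχ hPs hPc
  exact Precontraction.isPiecewiseChi_of_agree hχ hT hagree
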